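/- A seller must sell an asset within a marketing period of length $t\ge 0$. Offers arrive as a Poisson process of rate $\lambda>0$; their sizes are i.i.d. with distribution function $F$, where $X\sim F$ satisfies $E[\max(X,0)]<\infty$. If no offer has been accepted by the deadline, the asset is sold at a residual price $X_0$ with $E|X_0|<\infty$ and $\mu_0=E[X_0]\ge 0$; waiting times, offers and $X_0$ are independent. Rejected offers cannot be recalled, and a policy is a (measurable) rule for accepting or rejecting an offer depending on its size and on the time remaining. Let $\mu(t)$ be the maximal expected sale price over all policies when the remaining time is $t$; the optimal policy accepts an offer $x$ made when the remaining time is $s>0$ if and only if $x\ge\mu(s)$. Let $S_t$ be the realized sale price under this policy for the marketing period $t$. Put $$M=\sup\{x : F(x)<1\},\qquad \phi(x)=\int_x^\infty (1-F(u))\,du .$$ A measurable function $R:[0,\infty)\to[0,\infty)$ is regularly varying with exponent $\rho$ if $\lim_{s\to\infty}R(xs)/R(s)=x^\rho$ for all $x>0$. Theorem. Suppose $M=+\infty$ and, for some $p>0$, $$\lim_{x\to\infty}\frac{x\,\phi(x)}{\int_x^\infty\phi(u)\,du}=p .$$ Then $\mu(t)$ is regularly varying with exponent $\frac1{p+2}$;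 in particular $$\lim_{t\to\infty}\frac{\mu(t)}{t^c}=\begin{cases}+\infty & c<\frac1{p+2}\\ 0 & c>\frac1{p+2}.\end{cases}$$ If moreover $E[X_0^2]<\infty$, then $S_t$ is square integrable for every $t\ge0$ and $Var[S_t]$, as a function of $t$, is regularly varying with exponent $\frac2{p+2}$; in particular $$\lim_{t\to\infty}\frac{Var[S_t]}{t^c}=\begin{cases}+\infty & c<\frac2{p+2}\\ 0 & c>\frac2{p+2}.\end{cases}$$ -/

import Mathlib

open MeasureTheory ProbabilityTheory Filter Topology Set

namespace SellingProblem

noncomputable section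

/-- Sample space: the sequence of pairs (waiting time for the offer, size of the offer), together
with the residual price. Offers are numbered from `0`. -/
abbrev Outcome : Type := (ℕ → ℝ × ℝ) × ℝ

/-- Law of the randomness: the waiting times are exponential with rate `lam`, the offers have law
`ν`, the residual price has law `ν₀`, and all of them are independent. -/
def law (lam : ℝ) (ν ν₀ : Measure ℝ) : Measure Outcome :=
  (Measure.infinitePi fun _ : ℕ => (expMeasure lam).prod ν).prod ν₀

/-- Waiting time between offer `n - 1` (or the beginning, if `n = 0`) and offer `n`. -/
def waiting (n : ℕ) (ω : Outcome) : ℝ := (ω.1 n).1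

/-- Size of offer `n`. -/
def offer (n : ℕ) (ω : Outcome) : ℝ := (ω.1 n).2

/-- Price obtained at the deadline if no offer was accepted. -/
def residualPrice (ω : Outcome) : ℝ := ω.2

/-- Time remaining to the deadline, when the marketing period is `t`: at the beginning for index
`0`, on arrival of offer `n` for index `n + 1`; it is `0` once the deadline is reached. -/
def remaining (t : ℝ) (ω : Outcome) : ℕ → ℝ
  | 0 => t
  | n + 1 => max (remaining t ω n - waiting n ω) 0

/-- A policy is a set `A` of pairs (remaining time, offer) that the seller accepts. Offer `n` is
acceptable if it arrives before the deadline and lies in the acceptance set. -/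
def Acceptable (A : Set (ℝ × ℝ)) (t : ℝ) (ω : Outcome) (n : ℕ) : Prop :=
  0 < remaining t ω (n + 1) ∧ (remaining t ω (n + 1), offer n ω) ∈ A

open Classical in
/-- The realized sale price under the policy `A`: the first acceptable offer if there is one, and
the residual price otherwise. -/
def salePrice (A : Set (ℝ × ℝ)) (t : ℝ) (ω : Outcome) : ℝ :=
  if h : ∃ n, Acceptable A t ω n then offer (Nat.find h) ω else residualPrice ω

/-- `μ(t)`: the largest expected sale price over all policies, when the remaining time is `t`. -/
def optimalValue (lam : ℝ) (ν ν₀ : Measure ℝ) (t : ℝ) : ℝ :=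
  sSup {v : ℝ | ∃ A : Set (ℝ × ℝ), MeasurableSet A ∧
    Integrable (salePrice A t) (law lam ν ν₀) ∧ v = ∫ ω, salePrice A t ω ∂(law lam ν ν₀)}

/-- The optimal policy: an offer `x` made when the remaining time is `s` is accepted if and only if
`x ≥ μ(s)`. -/
def optimalPolicy (lam : ℝ) (ν ν₀ : Measure ℝ) : Set (ℝ × ℝ) :=
  {q | optimalValue lam ν ν₀ q.1 ≤ q.2}

/-- `S_t`: the realized sale price under the optimal policy, with marketing period `t`. -/
def optimalSalePrice (lam : ℝ) (ν ν₀ : Measure ℝ) (t : ℝ) : Outcome → ℝ :=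
  salePrice (optimalPolicy lam ν ν₀) t

/-- `Var[S_t]`. -/
def priceVariance (lam : ℝ) (ν ν₀ : Measure ℝ) (t : ℝ) : ℝ :=
  variance (optimalSalePrice lam ν ν₀ t) (law lam ν ν₀)

/-- `M = sup {x | F(x) < 1}`, possibly `+∞`, with `F` the distribution function of `ν`. -/
def supportSup (ν : Measure ℝ) : EReal :=
  sSup ((fun x : ℝ => (x : EReal)) '' {x : ℝ | cdf ν x < 1})

/-- `φ(x) = ∫ₓ^∞ (1 - F(u)) du`, with `F` the distribution function of `ν`. -/
def phi (ν : Measure ℝ) (x : ℝ) : ℝ := ∫ u in Ioi x, (1 - cdf ν u)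

/-- `R : [0,∞) → [0,∞)` (given as the restriction of a function on `ℝ`) is measurable and regularly
varying with exponent `ρ`. -/
structure RegularlyVarying (R : ℝ → ℝ) (ρ : ℝ) : Prop where
  measurable : Measurable (fun t : Ici (0 : ℝ) => R t)
  nonneg : ∀ t : ℝ, 0 ≤ t → 0 ≤ R t
  tendsto : ∀ x : ℝ, 0 < x → Tendsto (fun s : ℝ => R (x * s) / R s) atTop (𝓝 (x ^ ρ))

end

end SellingProblem

/-!
Write `μ₀` for the mean of the residual price, `φ(x) = E[(X - x)⁺]` and
`Φ(x) = ∫ₓ^∞ φ = E[((X - x)⁺)²] / 2`; a positive limit of `x φ(x) / Φ(x)` forces `Φ` to be finite.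

*The value function.* Conditioning on the first offer leads to `m' = λ φ(m)`, `m(0) = μ₀`. This
separable equation is solved by inverting `x ↦ ∫ du / (λ φ(u))` (`exists_solvesValueEquation`), and
`m` exists for all times because `φ` is bounded on `[μ₀, ∞)`, and it increases to infinity because
`φ` is positive and continuous. In integrated form, the equation says that `m` is a fixed point of
the one-step operator of the threshold policy `x ≥ m(s)`, and is not increased by the one-step
operator of any policy. Iterating the operator over the first `n` offers and letting `n → ∞`
(`lintegral_settled_le`, `lintegral_settled_eq`), which is justified since almost surely only
finitely many offers arrive in time, shows that `m` is the optimal value and that the threshold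
policy attains it. Expected rewards are computed in `[0, ∞]`: a negative accepted offer may be
replaced by `0` for the upper bound, and the threshold policy accepts only nonnegative offers.

*The variance.* The same method with the reward `x²` shows that the second moment of the price is
`m² + v`, where `v' = 2 λ Φ(m) - λ (1 - F(m)) v`. As `φ ∘ m` solves the homogeneous equation,
`v = φ(m) (v₀ / φ(μ₀) + ∫ 2 λ Φ(m) / φ(m))`. Atoms of the offer law only matter at countably many
times, since `m` is strictly increasing; the equation is understood with right derivatives.

*Asymptotics.* The derivative of `m² / Φ(m)` in time tends to `λ p (p + 2)`, so L'Hôpital's rule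
gives `m² / (t Φ(m)) → λ p (p + 2)` and hence `t m' / m → 1 / (p + 2)`
(`SolvesValueEquation.tendsto_logDeriv`). A function whose logarithmic derivative behaves in this
way is regularly varying and is compared with powers of `t` by L'Hôpital's rule for its logarithm.
Comparing the integral in the formula for `v` with `t m` shows that `v / m²` tends to
`2 / (p (p + 3))` (`SolvesValueEquation.tendsto_varianceSolution_div_sq`), so `v` has twice the
exponent of `m`.
-/

namespace SellingProblem

/-! ### Comparison of growth rates -/

/-- If `|f' - L g'| ≤ ε g'` then the increments of `f - L g` are at most `ε` times those of `g`. -/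
lemma abs_increment_le_of_deriv {f g f' g' : ℝ → ℝ} {L ε T : ℝ}
    (hf : ∀ x, T ≤ x → HasDerivAt f (f' x) x) (hg : ∀ x, T ≤ x → HasDerivAt g (g' x) x)
    (h : ∀ x, T ≤ x → |f' x - L * g' x| ≤ ε * g' x) {a b : ℝ} (ha : T ≤ a) (hab : a ≤ b) :
    |(f b - L * g b) - (f a - L * g a)| ≤ ε * (g b - g a) := by
  have key : ∀ σ : ℝ, |σ| = 1 →
      MonotoneOn (fun x => ε * g x - σ * (f x - L * g x)) (Ici T) := by
    intro σ hσ
    have hd : ∀ x, T ≤ x → HasDerivAt (fun x => ε * g x - σ * (f x - L * g x))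
        (ε * g' x - σ * (f' x - L * g' x)) x := fun x hx =>
      ((hg x hx).const_mul ε).sub (((hf x hx).sub ((hg x hx).const_mul L)).const_mul σ)
    refine monotoneOn_of_deriv_nonneg (convex_Ici T)
      (fun x hx => (hd x hx).continuousAt.continuousWithinAt)
      (fun x hx => (hd x (interior_subset hx)).differentiableAt.differentiableWithinAt)
      fun x hx => ?_
    rw [(hd x (interior_subset hx)).deriv, sub_nonneg]
    refine (le_abs_self _).trans ?_
    rw [abs_mul, hσ, one_mul]
    exact h x (interior_subset hx)
  have h1 := key 1 (by simp) (show a ∈ Ici T from ha) (show b ∈ Ici T from ha.trans hab) hab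
  have h2 := key (-1) (by simp) (show a ∈ Ici T from ha) (show b ∈ Ici T from ha.trans hab) hab
  simp only at h1 h2
  rw [abs_le]
  constructor <;> linarith

lemma eventually_abs_deriv_sub_le {f' g' : ℝ → ℝ} {L ε : ℝ} (hε : 0 < ε)
    (hpos : ∀ᶠ x in atTop, 0 < g' x) (hL : Tendsto (fun x => f' x / g' x) atTop (𝓝 L)) :
    ∀ᶠ x in atTop, |f' x - L * g' x| ≤ ε * g' x := by
  filter_upwards [hpos, Metric.tendsto_nhds.1 hL ε hε] with x hx h
  rw [Real.dist_eq] at h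
  have : f' x - L * g' x = (f' x / g' x - L) * g' x := by field_simp
  rw [this, abs_mul, abs_of_pos hx]
  exact mul_le_mul_of_nonneg_right h.le hx.le

/-- L'Hôpital's rule for quotients whose denominator tends to infinity. -/
lemma tendsto_div_of_tendsto_deriv_div {f g f' g' : ℝ → ℝ} {L : ℝ}
    (hf : ∀ᶠ x in atTop, HasDerivAt f (f' x) x) (hg : ∀ᶠ x in atTop, HasDerivAt g (g' x) x)
    (hpos : ∀ᶠ x in atTop, 0 < g' x) (hgtop : Tendsto g atTop atTop)
    (hL : Tendsto (fun x => f' x / g' x) atTop (𝓝 L)) :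
    Tendsto (fun x => f x / g x) atTop (𝓝 L) := by
  rw [Metric.tendsto_nhds]
  intro ε hε
  obtain ⟨T, hT⟩ := eventually_atTop.1
    (hf.and (hg.and (eventually_abs_deriv_sub_le (half_pos hε) hpos hL)))
  have hsmall : Tendsto (fun x => (|f T - L * g T| - ε / 2 * g T) / g x) atTop (𝓝 0) :=
    hgtop.const_div_atTop _
  filter_upwards [eventually_ge_atTop T, hgtop.eventually_gt_atTop 0,
    hsmall.eventually_lt_const (half_pos hε)] with x hx hgx hs
  have h := abs_increment_le_of_deriv (fun y hy => (hT y hy).1) (fun y hy => (hT y hy).2.1)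
    (fun y hy => (hT y hy).2.2) le_rfl hx
  rw [Real.dist_eq]
  have e : f x / g x - L = (f x - L * g x) / g x := by field_simp
  rw [e, abs_div, abs_of_pos hgx, div_lt_iff₀ hgx]
  rw [div_lt_iff₀ hgx] at hs
  have h3 : |f x - L * g x| ≤ |(f x - L * g x) - (f T - L * g T)| + |f T - L * g T| := by
    have := abs_add_le ((f x - L * g x) - (f T - L * g T)) (f T - L * g T)
    simpa using this
  nlinarith

/-- A function with `x f'(x) / f(x) → ρ` is regularly varying with exponent `ρ`: the increments of
`log f - ρ log` between `s` and `x s` vanish as `s → ∞`. -/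
lemma tendsto_ratio_of_logDeriv {f f' : ℝ → ℝ} {ρ : ℝ}
    (hf : ∀ᶠ x in atTop, HasDerivAt f (f' x) x) (hpos : ∀ᶠ x in atTop, 0 < f x)
    (hρ : Tendsto (fun x => x * f' x / f x) atTop (𝓝 ρ)) {x : ℝ} (hx : 0 < x) :
    Tendsto (fun s => f (x * s) / f s) atTop (𝓝 (x ^ ρ)) := by
  have hlog : Tendsto (fun s => Real.log (f (x * s)) - Real.log (f s)) atTop
      (𝓝 (ρ * Real.log x)) := by
    rw [Metric.tendsto_nhds]
    intro ε hε
    set δ := ε / (|Real.log x| + 1) with hδ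
    have hδ0 : 0 < δ := by positivity
    have hρ' : Tendsto (fun x => (f' x / f x) / x⁻¹) atTop (𝓝 ρ) := by
      refine hρ.congr fun y => ?_
      simp [div_eq_mul_inv]; ring
    have hp' : ∀ᶠ x : ℝ in atTop, 0 < x⁻¹ := by
      filter_upwards [eventually_gt_atTop 0] with y hy using inv_pos.2 hy
    obtain ⟨T, hT⟩ := eventually_atTop.1
      (hf.and (hpos.and ((eventually_abs_deriv_sub_le hδ0 hp' hρ').and (eventually_gt_atTop 0))))
    have hinc : ∀ a b, T ≤ a → a ≤ b → |(Real.log (f b) - ρ * Real.log b) -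
        (Real.log (f a) - ρ * Real.log a)| ≤ δ * (Real.log b - Real.log a) := fun a b ha hab =>
      abs_increment_le_of_deriv (f := fun y => Real.log (f y)) (g := Real.log)
        (fun y hy => (hT y hy).1.log (hT y hy).2.1.ne')
        (fun y hy => Real.hasDerivAt_log (hT y hy).2.2.2.ne')
        (fun y hy => (hT y hy).2.2.1) ha hab
    filter_upwards [eventually_ge_atTop T,
      (tendsto_id.const_mul_atTop hx).eventually_ge_atTop T] with s hs hxs
    simp only [id] at hxs
    have hs0 : 0 < s := (hT s hs).2.2.2
    have hlm : Real.log (x * s) = Real.log x + Real.log s := Real.log_mul hx.ne' hs0.ne'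
    have hfin : |Real.log (f (x * s)) - Real.log (f s) - ρ * Real.log x| ≤ δ * |Real.log x| := by
      rcases le_total 1 x with h1 | h1
      · have := hinc s (x * s) hs (by nlinarith)
        rw [hlm] at this
        rw [abs_of_nonneg (Real.log_nonneg h1)]
        convert this using 2 <;> ring
      · have := hinc (x * s) s hxs (by nlinarith)
        rw [hlm] at this
        rw [abs_of_nonpos (Real.log_nonpos hx.le h1), abs_sub_comm]
        convert this using 2
        · ring
        · ring
    rw [Real.dist_eq]
    refine hfin.trans_lt ?_
    rw [hδ, div_mul_eq_mul_div, div_lt_iff₀ (by positivity)]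
    nlinarith [abs_nonneg (Real.log x)]
  have := (Real.continuous_exp.tendsto _).comp hlog
  rw [mul_comm, ← Real.rpow_def_of_pos hx] at this
  refine this.congr' ?_
  filter_upwards [hpos, (tendsto_id.const_mul_atTop hx).eventually hpos] with s h1 h2
  simp only [id] at h2
  simp only [Function.comp]
  rw [Real.exp_sub, Real.exp_log h1, Real.exp_log h2]

lemma tendsto_log_div_log_of_logDeriv {f f' : ℝ → ℝ} {ρ : ℝ}
    (hf : ∀ᶠ x in atTop, HasDerivAt f (f' x) x) (hpos : ∀ᶠ x in atTop, 0 < f x)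
    (hρ : Tendsto (fun x => x * f' x / f x) atTop (𝓝 ρ)) :
    Tendsto (fun t => Real.log (f t) / Real.log t) atTop (𝓝 ρ) := by
  refine tendsto_div_of_tendsto_deriv_div (f' := fun x => f' x / f x) (g' := fun x => x⁻¹)
    ?_ ?_ ?_ Real.tendsto_log_atTop ?_
  · filter_upwards [hf, hpos] with x h1 h2 using h1.log h2.ne'
  · filter_upwards [eventually_gt_atTop 0] with x h using Real.hasDerivAt_log h.ne'
  · filter_upwards [eventually_gt_atTop 0] with x h using inv_pos.2 h
  · refine hρ.congr fun y => ?_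
    simp [div_eq_mul_inv]; ring

lemma div_rpow_eq_exp {f : ℝ → ℝ} (hpos : ∀ᶠ x in atTop, 0 < f x) (c : ℝ) :
    (fun t => Real.exp (Real.log t * (Real.log (f t) / Real.log t - c))) =ᶠ[atTop]
      fun t => f t / t ^ c := by
  filter_upwards [hpos, eventually_gt_atTop 1] with t ht h1
  have h0 : 0 < t := by linarith
  have hl : Real.log t ≠ 0 := (Real.log_pos h1).ne'
  rw [mul_sub, mul_div_cancel₀ _ hl, Real.exp_sub, Real.exp_log ht, Real.rpow_def_of_pos h0]

lemma tendsto_div_rpow_atTop_of_logDeriv {f f' : ℝ → ℝ} {ρ c : ℝ}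
    (hf : ∀ᶠ x in atTop, HasDerivAt f (f' x) x) (hpos : ∀ᶠ x in atTop, 0 < f x)
    (hρ : Tendsto (fun x => x * f' x / f x) atTop (𝓝 ρ)) (hc : c < ρ) :
    Tendsto (fun t => f t / t ^ c) atTop atTop := by
  have h := (tendsto_log_div_log_of_logDeriv hf hpos hρ).sub_const c
  exact (Real.tendsto_exp_atTop.comp
    (Real.tendsto_log_atTop.atTop_mul_pos (sub_pos.2 hc) h)).congr' (div_rpow_eq_exp hpos c)

lemma tendsto_div_rpow_zero_of_logDeriv {f f' : ℝ → ℝ} {ρ c : ℝ}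
    (hf : ∀ᶠ x in atTop, HasDerivAt f (f' x) x) (hpos : ∀ᶠ x in atTop, 0 < f x)
    (hρ : Tendsto (fun x => x * f' x / f x) atTop (𝓝 ρ)) (hc : ρ < c) :
    Tendsto (fun t => f t / t ^ c) atTop (𝓝 0) := by
  have h := (tendsto_log_div_log_of_logDeriv hf hpos hρ).sub_const c
  exact (Real.tendsto_exp_atBot.comp
    (Real.tendsto_log_atTop.atTop_mul_neg (sub_neg.2 hc) h)).congr' (div_rpow_eq_exp hpos c)

/-! ### The tail integrals of the offer distribution -/

/-- The iterated tail integral `∫ₓ^∞ φ(u) du`. -/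
noncomputable def iteratedTail (ν : Measure ℝ) (x : ℝ) : ℝ := ∫ u in Ioi x, phi ν u

lemma setIntegral_Ioi_eq_sub {f : ℝ → ℝ} (hf : ∀ x, IntegrableOn f (Ioi x)) (a x : ℝ) :
    ∫ u in Ioi x, f u = (∫ u in Ioi a, f u) - ∫ u in a..x, f u := by
  rw [← intervalIntegral.integral_interval_add_Ioi (hf a) (hf x)]; ring

lemma intervalIntegrable_of_integrableOn_Ioi {f : ℝ → ℝ} (hf : ∀ x, IntegrableOn f (Ioi x))
    (a b : ℝ) : IntervalIntegrable f volume a b := by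
  rw [intervalIntegrable_iff]
  exact (hf (min a b)).mono_set fun x hx => hx.1

section
variable (ν : Measure ℝ)

lemma ofReal_one_sub_cdf [IsProbabilityMeasure ν] (u : ℝ) :
    ENNReal.ofReal (1 - cdf ν u) = ν (Ioi u) := by
  have h : ν (Ioi u) = 1 - ν (Iic u) := by
    rw [← compl_Iic, prob_compl_eq_one_sub measurableSet_Iic]
  rw [h, ← ofReal_cdf, ENNReal.ofReal_sub _ (cdf_nonneg ν u), ENNReal.ofReal_one]

lemma one_sub_cdf_nonneg (u : ℝ) : 0 ≤ 1 - cdf ν u := sub_nonneg.2 (cdf_le_one ν u)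

lemma measurable_one_sub_cdf : Measurable fun u => 1 - cdf ν u :=
  measurable_const.sub (monotone_cdf ν).measurable

/-- The expected excess of an offer over `x` is the integral of its tail beyond `x`. -/
lemma lintegral_tail_eq [IsProbabilityMeasure ν] (x : ℝ) :
    ∫⁻ u in Ioi x, ν (Ioi u) = ∫⁻ y, ENNReal.ofReal (y - x) ∂ν := by
  have hm : Measurable (Function.uncurry fun (u y : ℝ) =>
      (Ioi u).indicator (fun _ => (1 : ENNReal)) y) := by
    have : (Function.uncurry fun (u y : ℝ) => (Ioi u).indicator (fun _ => (1 : ENNReal)) y)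
        = {q : ℝ × ℝ | q.1 < q.2}.indicator fun _ => 1 := by
      ext q; simp [indicator, Function.uncurry]
    rw [this]
    exact measurable_const.indicator (measurableSet_lt measurable_fst measurable_snd)
  calc ∫⁻ u in Ioi x, ν (Ioi u)
      = ∫⁻ u in Ioi x, ∫⁻ y, (Ioi u).indicator (fun _ => (1 : ENNReal)) y ∂ν := by
        simp [lintegral_indicator measurableSet_Ioi]
    _ = ∫⁻ y, (∫⁻ u in Ioi x, (Ioi u).indicator (fun _ => (1 : ENNReal)) y) ∂ν :=
        lintegral_lintegral_swap hm.aemeasurable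
    _ = _ := by
        refine lintegral_congr fun y => ?_
        have : (fun u => (Ioi u).indicator (fun _ => (1 : ENNReal)) y)
            = (Iio y).indicator fun _ => 1 := by
          ext u; simp [indicator]
        rw [this, lintegral_indicator measurableSet_Iio, Measure.restrict_restrict
          measurableSet_Iio, setLIntegral_one, inter_comm, Ioi_inter_Iio, Real.volume_Ioo]

variable {ν}

lemma lintegral_ofReal_sub_lt_top [IsProbabilityMeasure ν]
    (hν : Integrable (fun x : ℝ => max x 0) ν) (x : ℝ) :
    ∫⁻ y, ENNReal.ofReal (y - x) ∂ν < ⊤ := by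
  refine lt_of_le_of_lt (lintegral_mono fun y => ENNReal.ofReal_le_ofReal
    (show y - x ≤ max y 0 + |x| by linarith [le_max_left y 0, neg_abs_le x])) ?_
  exact (hν.add (integrable_const |x|)).lintegral_lt_top

lemma integrableOn_one_sub_cdf [IsProbabilityMeasure ν] (hν : Integrable (fun x : ℝ => max x 0) ν)
    (x : ℝ) :
    IntegrableOn (fun u => 1 - cdf ν u) (Ioi x) := by
  refine ⟨(measurable_one_sub_cdf ν).aestronglyMeasurable, ?_⟩
  rw [hasFiniteIntegral_iff_ofReal (ae_of_all _ fun u => one_sub_cdf_nonneg ν u)]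
  simp_rw [ofReal_one_sub_cdf, lintegral_tail_eq]
  exact lintegral_ofReal_sub_lt_top hν x

/-- `φ(x) = E[(X - x)⁺]`. -/
lemma ofReal_phi [IsProbabilityMeasure ν] (hν : Integrable (fun x : ℝ => max x 0) ν) (x : ℝ) :
    ENNReal.ofReal (phi ν x) = ∫⁻ y, ENNReal.ofReal (y - x) ∂ν := by
  rw [phi, ofReal_integral_eq_lintegral_ofReal (integrableOn_one_sub_cdf hν x)
    (ae_of_all _ fun u => one_sub_cdf_nonneg ν u)]
  simp_rw [ofReal_one_sub_cdf, lintegral_tail_eq]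

lemma phi_nonneg (x : ℝ) : 0 ≤ phi ν x :=
  integral_nonneg fun u => one_sub_cdf_nonneg ν u

lemma phi_hasDerivWithinAt [IsProbabilityMeasure ν] (hν : Integrable (fun x : ℝ => max x 0) ν)
    (x : ℝ) :
    HasDerivWithinAt (phi ν) (-(1 - cdf ν x)) (Ici x) x := by
  have h : phi ν = fun y => phi ν 0 - ∫ u in (0:ℝ)..y, (1 - cdf ν u) :=
    funext fun y => setIntegral_Ioi_eq_sub (integrableOn_one_sub_cdf hν) 0 y
  rw [h]
  refine HasDerivWithinAt.const_sub _ ?_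
  refine intervalIntegral.integral_hasDerivWithinAt_right (t := Ioi x)
    (intervalIntegrable_of_integrableOn_Ioi (integrableOn_one_sub_cdf hν) 0 x)
    ((measurable_one_sub_cdf ν).stronglyMeasurable.stronglyMeasurableAtFilter) ?_
  exact continuousWithinAt_const.sub
    (((cdf ν).right_continuous x).mono Ioi_subset_Ici_self)

lemma phi_continuous [IsProbabilityMeasure ν] (hν : Integrable (fun x : ℝ => max x 0) ν)
    : Continuous (phi ν) := by
  have h : phi ν = fun y => phi ν 0 - ∫ u in (0:ℝ)..y, (1 - cdf ν u) :=
    funext fun y => setIntegral_Ioi_eq_sub (integrableOn_one_sub_cdf hν) 0 y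
  rw [h]
  exact continuous_const.sub (intervalIntegral.continuous_primitive
    (intervalIntegrable_of_integrableOn_Ioi (integrableOn_one_sub_cdf hν)) 0)

lemma phi_antitone [IsProbabilityMeasure ν] (hν : Integrable (fun x : ℝ => max x 0) ν)
    : Antitone (phi ν) :=
  fun _ _ hab => setIntegral_mono_set (integrableOn_one_sub_cdf hν _)
    (ae_of_all _ fun u => one_sub_cdf_nonneg ν u) (Ioi_subset_Ioi hab).eventuallyLE

/-- For `M = ∞` the distribution function never reaches `1`. -/
lemma cdf_lt_one_of_supportSup_eq_top (hM : supportSup ν = ⊤) (x : ℝ) : cdf ν x < 1 := by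
  have h : ((x : ℝ) : EReal) < supportSup ν := hM ▸ EReal.coe_lt_top x
  obtain ⟨_, ⟨y, hy, rfl⟩, hxy⟩ := lt_sSup_iff.1 h
  exact (monotone_cdf ν (EReal.coe_lt_coe_iff.1 hxy).le).trans_lt hy

lemma setIntegral_Ioi_pos {f : ℝ → ℝ} {x : ℝ} (hf : IntegrableOn f (Ioi x)) (hpos : ∀ u, 0 < f u) :
    0 < ∫ u in Ioi x, f u := by
  rw [setIntegral_pos_iff_support_of_nonneg_ae (ae_of_all _ fun u => (hpos u).le) hf]
  have : Function.support f = univ := eq_univ_of_forall fun u => (hpos u).ne'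
  simp [this]

lemma phi_pos [IsProbabilityMeasure ν] (hν : Integrable (fun x : ℝ => max x 0) ν)
    (hM : supportSup ν = ⊤) (x : ℝ) :
    0 < phi ν x :=
  setIntegral_Ioi_pos (integrableOn_one_sub_cdf hν x)
    fun u => sub_pos.2 (cdf_lt_one_of_supportSup_eq_top hM u)

/-- A nonzero limit of `x φ(x) / ∫ₓ^∞ φ` forces `φ` to be integrable at infinity, since a divergent
integral would make the quotient `0`. -/
lemma integrableOn_phi [IsProbabilityMeasure ν] (hν : Integrable (fun x : ℝ => max x 0) ν)
    {p : ℝ} (hp : 0 < p)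
    (hφ : Tendsto (fun x : ℝ => x * phi ν x / iteratedTail ν x) atTop (𝓝 p)) (x : ℝ) :
    IntegrableOn (phi ν) (Ioi x) := by
  obtain ⟨y, hy, hxy⟩ := ((hφ.eventually_const_lt hp).and (eventually_ge_atTop x)).exists
  have h : IntegrableOn (phi ν) (Ioi y) := by
    by_contra hn
    have : iteratedTail ν y = 0 := integral_undef hn
    simp [this] at hy
  rw [← Ioc_union_Ioi_eq_Ioi hxy]
  exact ((phi_continuous hν).integrableOn_Icc.mono_set Ioc_subset_Icc_self).union h

lemma iteratedTail_hasDerivAt [IsProbabilityMeasure ν] (hν : Integrable (fun x : ℝ => max x 0) ν)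
    (hi : ∀ x, IntegrableOn (phi ν) (Ioi x)) (x : ℝ) :
    HasDerivAt (iteratedTail ν) (-phi ν x) x := by
  have h : iteratedTail ν = fun y => iteratedTail ν 0 - ∫ u in (0:ℝ)..y, phi ν u :=
    funext fun y => setIntegral_Ioi_eq_sub hi 0 y
  rw [h]
  exact ((phi_continuous hν).integral_hasStrictDerivAt 0 x).hasDerivAt.const_sub _

lemma iteratedTail_continuous [IsProbabilityMeasure ν] (hν : Integrable (fun x : ℝ => max x 0) ν)
    (hi : ∀ x, IntegrableOn (phi ν) (Ioi x)) : Continuous (iteratedTail ν) :=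
  continuous_iff_continuousAt.2 fun x => (iteratedTail_hasDerivAt hν hi x).continuousAt

lemma lintegral_ofReal_sub_Ioi (x y : ℝ) :
    ∫⁻ u in Ioi x, ENNReal.ofReal (y - u) = ENNReal.ofReal ((max (y - x) 0) ^ 2 / 2) := by
  rcases le_or_gt y x with h | h
  · rw [max_eq_right (by linarith)]
    simp only [ne_eq, OfNat.ofNat_ne_zero, not_false_eq_true, zero_pow, zero_div,
      ENNReal.ofReal_zero]
    rw [setLIntegral_eq_zero_iff measurableSet_Ioi (by fun_prop)]
    refine ae_of_all _ fun u hu => ENNReal.ofReal_of_nonpos ?_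
    have : x < u := hu
    linarith
  · rw [max_eq_left (by linarith), ← Ioc_union_Ioi_eq_Ioi h.le,
      lintegral_union measurableSet_Ioi
        (disjoint_left.2 fun u hu hu' => not_lt_of_ge hu.2 hu')]
    have h2 : ∫⁻ u in Ioi y, ENNReal.ofReal (y - u) = 0 := by
      rw [setLIntegral_eq_zero_iff measurableSet_Ioi (by fun_prop)]
      refine ae_of_all _ fun u hu => ENNReal.ofReal_of_nonpos ?_
      have : y < u := hu
      linarith
    have hc : Continuous fun u : ℝ => y - u := by fun_prop
    rw [h2, add_zero, ← ofReal_integral_eq_lintegral_ofReal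
      (hc.integrableOn_Icc.mono_set Ioc_subset_Icc_self),
      ← intervalIntegral.integral_of_le h.le]
    · congr 1
      rw [intervalIntegral.integral_comp_sub_left (fun u => u) y]
      simp
    · filter_upwards [ae_restrict_mem measurableSet_Ioc] with u hu
      exact sub_nonneg.2 hu.2

/-- `∫ₓ^∞ φ(u) du = E[((X - x)⁺)²] / 2`. -/
lemma ofReal_iteratedTail [IsProbabilityMeasure ν] (hν : Integrable (fun x : ℝ => max x 0) ν)
    (hi : ∀ x, IntegrableOn (phi ν) (Ioi x)) (x : ℝ) :
    ENNReal.ofReal (iteratedTail ν x) =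
      ∫⁻ y, ENNReal.ofReal ((max (y - x) 0) ^ 2 / 2) ∂ν := by
  rw [iteratedTail, ofReal_integral_eq_lintegral_ofReal (hi x)
    (ae_of_all _ fun u => phi_nonneg u)]
  simp_rw [ofReal_phi hν]
  rw [lintegral_lintegral_swap (by
    simp only [Function.uncurry_def]; fun_prop)]
  simp_rw [lintegral_ofReal_sub_Ioi]

end

/-! ### The differential equation of the value function -/

/-- `m` solves `m' = λ φ(m)`, `m(0) = a` on `[0,∞)`, and increases to infinity. The values of `m`
at negative times are irrelevant. -/
structure SolvesValueEquation (lam : ℝ) (ν : Measure ℝ) (a : ℝ) (m : ℝ → ℝ) : Prop where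
  zero : m 0 = a
  hasDerivAt : ∀ t, 0 ≤ t → HasDerivAt m (lam * phi ν (m t)) t
  continuous : Continuous m
  strictMono : StrictMono m
  tendsto : Tendsto m atTop atTop

lemma SolvesValueEquation.le {lam a : ℝ} {ν : Measure ℝ} {m : ℝ → ℝ}
    (hm : SolvesValueEquation lam ν a m) {t : ℝ} (ht : 0 ≤ t) : a ≤ m t :=
  hm.zero ▸ hm.strictMono.monotone ht

/-- The equation is separable: the solution is the inverse of `x ↦ ∫ₐˣ du / (λ φ(u))`. Freezing
`φ` below `a` makes this function a bijection of `ℝ` and does not change the solution on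
`[0,∞)`. -/
lemma exists_solvesValueEquation {lam : ℝ} (hlam : 0 < lam) {ν : Measure ℝ}
    [IsProbabilityMeasure ν] (hν : Integrable (fun x : ℝ => max x 0) ν)
    (hM : supportSup ν = ⊤) (a : ℝ) : ∃ m, SolvesValueEquation lam ν a m := by
  set k : ℝ → ℝ := fun u => (lam * phi ν (max u a))⁻¹ with hk
  have hφ0 := phi_pos hν hM
  have hkc : Continuous k := by
    refine Continuous.inv₀ (continuous_const.mul ((phi_continuous hν).comp (by fun_prop)))
      fun u => (mul_pos hlam (hφ0 _)).ne'
  set δ := (lam * phi ν a)⁻¹ with hδ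
  have hδ0 : 0 < δ := inv_pos.2 (mul_pos hlam (hφ0 a))
  have hkδ : ∀ u, δ ≤ k u := fun u =>
    inv_anti₀ (mul_pos hlam (hφ0 _))
      (mul_le_mul_of_nonneg_left (phi_antitone hν (le_max_right u a)) hlam.le)
  set G : ℝ → ℝ := fun x => ∫ u in a..x, k u with hG
  have hGd : ∀ x, HasDerivAt G (k x) x := fun x =>
    (hkc.integral_hasStrictDerivAt a x).hasDerivAt
  have hGc : Continuous G := continuous_iff_continuousAt.2 fun x => (hGd x).continuousAt
  have hGinc : ∀ x y, x ≤ y → δ * (y - x) ≤ G y - G x := by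
    intro x y hxy
    have h := intervalIntegral.integral_interval_sub_left
      (hkc.intervalIntegrable (μ := volume) a y) (hkc.intervalIntegrable a x)
    rw [hG]; simp only; rw [h]
    have h2 := intervalIntegral.integral_mono_on hxy
      (continuous_const.intervalIntegrable (μ := volume) x y) (hkc.intervalIntegrable x y)
      fun u _ => hkδ u
    simpa [mul_comm] using h2
  have hGa : G a = 0 := by simp [hG]
  have hGmono : StrictMono G := fun x y hxy => by
    have := hGinc x y hxy.le
    have : 0 < δ * (y - x) := mul_pos hδ0 (sub_pos.2 hxy)
    linarith
  have htop : Tendsto G atTop atTop := by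
    refine tendsto_atTop_mono' atTop (f₁ := fun x => δ * (x - a)) ?_
      ((tendsto_atTop_add_const_right _ (-a) tendsto_id).const_mul_atTop hδ0)
    filter_upwards [eventually_ge_atTop a] with x hx
    have := hGinc a x hx
    simpa [hGa] using this
  have hbot : Tendsto G atBot atBot := by
    refine tendsto_atBot_mono' atBot (f₁ := fun x => δ * (x - a)) ?_
      ((tendsto_atBot_add_const_right _ (-a) tendsto_id).const_mul_atBot hδ0)
    filter_upwards [eventually_le_atBot a] with x hx
    have := hGinc x a hx
    rw [hGa] at this
    linarith
  have hsurj : Function.Surjective G := hGc.surjective htop hbot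
  let e : ℝ ≃o ℝ := hGmono.orderIsoOfSurjective G hsurj
  have hGe : ∀ t, G (e.symm t) = t := fun t => e.apply_symm_apply t
  have h0 : e.symm 0 = a := hGmono.injective (by rw [hGe, hGa])
  refine ⟨e.symm, h0, fun t ht => ?_, e.symm.continuous, e.symm.strictMono,
    e.symm.tendsto_atTop⟩
  have h := HasDerivAt.of_local_left_inverse e.symm.continuous.continuousAt
    (hGd (e.symm t)) (hδ0.trans_le (hkδ _)).ne' (Eventually.of_forall hGe)
  have hle : a ≤ e.symm t := h0 ▸ e.symm.monotone ht
  simpa [hk, max_eq_left hle] using h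

/-! ### Growth of the value function -/

section
variable {lam p a : ℝ} {ν : Measure ℝ} [IsProbabilityMeasure ν] {m : ℝ → ℝ}

lemma iteratedTail_pos (hν : Integrable (fun x : ℝ => max x 0) ν) (hM : supportSup ν = ⊤)
    (hi : ∀ x, IntegrableOn (phi ν) (Ioi x)) (x : ℝ) : 0 < iteratedTail ν x :=
  setIntegral_Ioi_pos (hi x) (phi_pos hν hM)

/-- The function `m² / ∫ₘ^∞ φ` of time has a derivative tending to `λ p (p + 2)`, hence grows
linearly; comparing it with `t` gives the logarithmic derivative of `m`. -/
lemma SolvesValueEquation.tendsto_logDeriv (hm : SolvesValueEquation lam ν a m) (hlam : 0 < lam)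
    (hp : 0 < p) (hν : Integrable (fun x : ℝ => max x 0) ν) (hM : supportSup ν = ⊤)
    (hφ : Tendsto (fun x : ℝ => x * phi ν x / iteratedTail ν x) atTop (𝓝 p)) :
    Tendsto (fun t => t * (lam * phi ν (m t)) / m t) atTop (𝓝 (1 / (p + 2))) := by
  have hi := integrableOn_phi hν hp hφ
  have hT := iteratedTail_pos hν hM hi
  set q : ℝ → ℝ := fun t => m t * phi ν (m t) / iteratedTail ν (m t) with hq
  have hqp : Tendsto q atTop (𝓝 p) := hφ.comp hm.tendsto
  have hK : Tendsto (fun t => (m t ^ 2 / iteratedTail ν (m t)) / t) atTop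
      (𝓝 (lam * p * (p + 2))) := by
    refine tendsto_div_of_tendsto_deriv_div (f' := fun t => lam * q t * (q t + 2))
      (g' := fun _ => 1) ?_ (Eventually.of_forall hasDerivAt_id)
      (Eventually.of_forall fun _ => one_pos) tendsto_id ?_
    · filter_upwards [eventually_ge_atTop 0] with t ht
      have h := ((hm.hasDerivAt t ht).pow 2).div
        ((iteratedTail_hasDerivAt hν hi (m t)).comp t (hm.hasDerivAt t ht)) (hT (m t)).ne'
      refine HasDerivAt.congr_deriv (f := fun t => m t ^ 2 / iteratedTail ν (m t)) h ?_
      have := (hT (m t)).ne'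
      simp only [hq, Function.comp, Pi.pow_apply]
      field_simp
      ring
    · simpa using (hqp.const_mul lam).mul (hqp.add_const 2)
  have hne : lam * p * (p + 2) ≠ 0 := by positivity
  have := (hqp.const_mul lam).div hK hne
  have e : lam * p / (lam * p * (p + 2)) = 1 / (p + 2) := by field_simp
  rw [e] at this
  refine this.congr' ?_
  filter_upwards [hm.tendsto.eventually_gt_atTop 0, eventually_gt_atTop 0] with t h1 h2
  have := (hT (m t)).ne'
  simp only [hq, Pi.div_apply]
  field_simp

/-- The variance of the optimal sale price, written in terms of the value function `m`: the solution
of `v' = 2 λ ∫ₘ^∞ φ - λ (1 - F(m)) v` with `v(0) = v₀`, obtained by variation of constants, `φ ∘ m`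
being a solution of the homogeneous equation. -/
noncomputable def varianceSolution (lam : ℝ) (ν : Measure ℝ) (m : ℝ → ℝ) (v₀ t : ℝ) : ℝ :=
  phi ν (m t) *
    (v₀ / phi ν (m 0) + ∫ s in (0:ℝ)..t, 2 * lam * iteratedTail ν (m s) / phi ν (m s))

lemma SolvesValueEquation.continuous_integrand (hm : SolvesValueEquation lam ν a m)
    (hν : Integrable (fun x : ℝ => max x 0) ν) (hM : supportSup ν = ⊤)
    (hi : ∀ x, IntegrableOn (phi ν) (Ioi x)) :
    Continuous fun s => 2 * lam * iteratedTail ν (m s) / phi ν (m s) :=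
  (continuous_const.mul ((iteratedTail_continuous hν hi).comp hm.continuous)).div
    ((phi_continuous hν).comp hm.continuous) fun s => (phi_pos hν hM (m s)).ne'

lemma SolvesValueEquation.hasDerivAt_constant (hm : SolvesValueEquation lam ν a m)
    (hν : Integrable (fun x : ℝ => max x 0) ν) (hM : supportSup ν = ⊤)
    (hi : ∀ x, IntegrableOn (phi ν) (Ioi x)) (c t : ℝ) :
    HasDerivAt (fun t => c + ∫ s in (0:ℝ)..t, 2 * lam * iteratedTail ν (m s) / phi ν (m s))
      (2 * lam * iteratedTail ν (m t) / phi ν (m t)) t :=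
  ((hm.continuous_integrand hν hM hi).integral_hasStrictDerivAt 0 t).hasDerivAt.const_add c

lemma SolvesValueEquation.continuous_varianceSolution (hm : SolvesValueEquation lam ν a m)
    (hν : Integrable (fun x : ℝ => max x 0) ν) (hM : supportSup ν = ⊤)
    (hi : ∀ x, IntegrableOn (phi ν) (Ioi x)) (v₀ : ℝ) :
    Continuous (varianceSolution lam ν m v₀) :=
  ((phi_continuous hν).comp hm.continuous).mul (continuous_iff_continuousAt.2 fun t =>
    (hm.hasDerivAt_constant hν hM hi _ t).continuousAt)

lemma varianceSolution_zero (hν : Integrable (fun x : ℝ => max x 0) ν)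
    (hM : supportSup ν = ⊤) (v₀ : ℝ) : varianceSolution lam ν m v₀ 0 = v₀ := by
  have := (phi_pos hν hM (m 0)).ne'
  simp [varianceSolution]
  field_simp

omit [IsProbabilityMeasure ν] in
lemma varianceSolution_nonneg (hlam : 0 < lam) {v₀ t : ℝ} (hv₀ : 0 ≤ v₀) (ht : 0 ≤ t) :
    0 ≤ varianceSolution lam ν m v₀ t := by
  refine mul_nonneg (phi_nonneg _) (add_nonneg (div_nonneg hv₀ (phi_nonneg _))
    (intervalIntegral.integral_nonneg ht fun s _ => div_nonneg (mul_nonneg (by positivity)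
      (integral_nonneg fun u => phi_nonneg u)) (phi_nonneg _)))

/-- Only the right derivative exists in general, because `F` may jump at `m(t)`. -/
lemma SolvesValueEquation.varianceSolution_hasDerivWithinAt (hm : SolvesValueEquation lam ν a m)
    (hν : Integrable (fun x : ℝ => max x 0) ν) (hM : supportSup ν = ⊤)
    (hi : ∀ x, IntegrableOn (phi ν) (Ioi x)) (v₀ : ℝ) {t : ℝ} (ht : 0 ≤ t) :
    HasDerivWithinAt (varianceSolution lam ν m v₀)
      (2 * lam * iteratedTail ν (m t) - lam * (1 - cdf ν (m t)) * varianceSolution lam ν m v₀ t)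
      (Ioi t) t := by
  have h1 : HasDerivWithinAt (fun s => phi ν (m s))
      (-(1 - cdf ν (m t)) * (lam * phi ν (m t))) (Ioi t) t :=
    (phi_hasDerivWithinAt hν (m t)).comp t (hm.hasDerivAt t ht).hasDerivWithinAt
      fun s hs => hm.strictMono.monotone (le_of_lt hs)
  have h2 := h1.mul (hm.hasDerivAt_constant hν hM hi (v₀ / phi ν (m 0)) t).hasDerivWithinAt
  refine h2.congr_deriv ?_
  have := (phi_pos hν hM (m t)).ne'
  simp only [varianceSolution]
  field_simp
  ring

/-- The variance is asymptotically proportional to the square of the value. -/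
lemma SolvesValueEquation.tendsto_varianceSolution_div_sq (hm : SolvesValueEquation lam ν a m)
    (hlam : 0 < lam) (hp : 0 < p) (hν : Integrable (fun x : ℝ => max x 0) ν)
    (hM : supportSup ν = ⊤)
    (hφ : Tendsto (fun x : ℝ => x * phi ν x / iteratedTail ν x) atTop (𝓝 p)) (v₀ : ℝ) :
    Tendsto (fun t => varianceSolution lam ν m v₀ t / m t ^ 2) atTop
      (𝓝 (2 / (p * (p + 3)))) := by
  have hi := integrableOn_phi hν hp hφ
  have hT := iteratedTail_pos hν hM hi
  have hlog := hm.tendsto_logDeriv hlam hp hν hM hφ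
  have hw : Tendsto (fun t => (v₀ / phi ν (m 0) +
      ∫ s in (0:ℝ)..t, 2 * lam * iteratedTail ν (m s) / phi ν (m s)) / (t * m t)) atTop
      (𝓝 (2 * lam * p⁻¹ / (1 + 1 / (p + 2)))) := by
    -- The integrand is asymptotic to `2 λ m / p` and the derivative of `t m(t)` to
    -- `(1 + 1 / (p + 2)) m`.
    refine tendsto_div_of_tendsto_deriv_div
      (f' := fun t => 2 * lam * iteratedTail ν (m t) / phi ν (m t))
      (g' := fun t => m t + t * (lam * phi ν (m t)))
      (Eventually.of_forall (hm.hasDerivAt_constant hν hM hi _)) ?_ ?_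
      (tendsto_id.atTop_mul_atTop₀ hm.tendsto) ?_
    · filter_upwards [eventually_ge_atTop 0] with t ht
      exact ((hasDerivAt_id' t).mul (hm.hasDerivAt t ht)).congr_deriv (by ring)
    · filter_upwards [eventually_ge_atTop 0, hm.tendsto.eventually_gt_atTop 0] with t h1 h2
      have := phi_nonneg (ν := ν) (m t)
      positivity
    · have hq := ((hφ.comp hm.tendsto).inv₀ hp.ne').const_mul (2 * lam)
      refine (hq.div (hlog.const_add 1) (by positivity)).congr' ?_
      filter_upwards [eventually_ge_atTop 0, hm.tendsto.eventually_gt_atTop 0] with t h1 h2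
      have h3 := phi_pos hν hM (m t)
      have h4 := hT (m t)
      simp only [Function.comp, Pi.div_apply]
      field_simp
  have h := (hw.mul hlog).div_const lam
  have e : 2 * lam * p⁻¹ / (1 + 1 / (p + 2)) * (1 / (p + 2)) / lam = 2 / (p * (p + 3)) := by
    field_simp
    ring
  rw [e] at h
  refine h.congr' ?_
  filter_upwards [eventually_gt_atTop 0, hm.tendsto.eventually_gt_atTop 0] with t h1 h2
  simp only [varianceSolution]
  field_simp

end

/-! ### Splitting off the first term of an i.i.d. sequence -/

/-- Prepend a term to a sequence. -/
def prepend {α : Type*} (q : α) (w : ℕ → α) : ℕ → α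
  | 0 => q
  | n + 1 => w n

lemma measurable_prepend {α : Type*} [MeasurableSpace α] :
    Measurable fun z : α × (ℕ → α) => prepend z.1 z.2 := by
  refine measurable_pi_lambda _ fun n => ?_
  cases n with
  | zero => exact measurable_fst
  | succ n => exact (measurable_pi_apply n).comp measurable_snd

lemma map_prepend_infinitePi {α : Type*} [MeasurableSpace α] (Q : Measure α)
    [IsProbabilityMeasure Q] :
    (Q.prod (Measure.infinitePi fun _ : ℕ => Q)).map (fun z => prepend z.1 z.2) =
      Measure.infinitePi fun _ : ℕ => Q := by
  classical
  refine Measure.eq_infinitePi _ fun s t ht => ?_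
  obtain ⟨N, hN⟩ : ∃ N, s ⊆ Finset.range (N + 1) :=
    ⟨s.sup id, fun i hi => Finset.mem_range_succ_iff.2 (Finset.le_sup (f := id) hi)⟩
  -- Enlarge the box to an initial segment of indices, with trivial sides outside `s`.
  set t' : ℕ → Set α := fun i => if i ∈ s then t i else univ with ht'
  have hm' : ∀ i, MeasurableSet (t' i) := fun i => by
    simp only [ht']; split_ifs
    exacts [ht i, MeasurableSet.univ]
  have hbox : (s : Set ℕ).pi t = ((Finset.range (N + 1) : Finset ℕ) : Set ℕ).pi t' := by
    ext w
    simp only [Set.mem_pi, Finset.mem_coe, ht']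
    refine ⟨fun h i _ => ?_, fun h i hi => by simpa [hi] using h i (hN hi)⟩
    split_ifs with hi
    exacts [h i hi, mem_univ _]
  have hprod : ∏ i ∈ s, Q (t i) = ∏ i ∈ Finset.range (N + 1), Q (t' i) := by
    rw [← Finset.prod_subset hN fun i _ hi => by simp [ht', hi]]
    exact Finset.prod_congr rfl fun i hi => by simp [ht', hi]
  have hpre : (fun z : α × (ℕ → α) => prepend z.1 z.2) ⁻¹'
      (((Finset.range (N + 1) : Finset ℕ) : Set ℕ).pi t') =
      t' 0 ×ˢ ((Finset.range N : Finset ℕ) : Set ℕ).pi fun i => t' (i + 1) := by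
    ext z
    simp only [mem_preimage, Set.mem_pi, mem_prod, Finset.coe_range, mem_Iio]
    refine ⟨fun h => ⟨h 0 (by omega), fun i hi => h (i + 1) (by omega)⟩, fun h i hi => ?_⟩
    cases i with
    | zero => exact h.1
    | succ i => exact h.2 i (by omega)
  rw [hbox, hprod, Measure.map_apply measurable_prepend
    (MeasurableSet.pi (Finset.countable_toSet _) fun i _ => hm' i), hpre, Measure.prod_prod,
    Measure.infinitePi_pi _ fun i _ => hm' (i + 1), Finset.prod_range_succ', mul_comm]

lemma lintegral_infinitePi_prepend {α : Type*} [MeasurableSpace α] (Q : Measure α)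
    [IsProbabilityMeasure Q] {f : (ℕ → α) → ENNReal} (hf : Measurable f) :
    ∫⁻ w, f w ∂(Measure.infinitePi fun _ : ℕ => Q) =
      ∫⁻ q, (∫⁻ w, f (prepend q w) ∂(Measure.infinitePi fun _ : ℕ => Q)) ∂Q := by
  conv_lhs => rw [← map_prepend_infinitePi Q]
  rw [lintegral_map hf measurable_prepend]
  exact lintegral_prod _ (hf.comp measurable_prepend).aemeasurable

/-! ### Pathwise recursion for the sale price -/

/-- Time remaining on the arrival of an offer `q = (waiting time, size)`. -/
noncomputable def nextTime (t : ℝ) (q : ℝ × ℝ) : ℝ := max (t - q.1) 0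

lemma measurable_nextTime : Measurable fun z : ℝ × (ℝ × ℝ) => nextTime z.1 z.2 := by
  unfold nextTime; fun_prop

lemma nextTime_nonneg (t : ℝ) (q : ℝ × ℝ) : 0 ≤ nextTime t q := le_max_right _ _

/-- The problem seen from the arrival of the first offer. -/
def shift (ω : Outcome) : Outcome := (fun k => ω.1 (k + 1), ω.2)

lemma remaining_succ_eq_shift (t : ℝ) (ω : Outcome) (n : ℕ) :
    remaining t ω (n + 1) = remaining (nextTime t (ω.1 0)) (shift ω) n := by
  induction n with
  | zero => rfl
  | succ n ih => rw [remaining, ih]; rfl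

lemma acceptable_succ_iff (A : Set (ℝ × ℝ)) (t : ℝ) (ω : Outcome) (n : ℕ) :
    Acceptable A t ω (n + 1) ↔ Acceptable A (nextTime t (ω.1 0)) (shift ω) n := by
  unfold Acceptable
  rw [remaining_succ_eq_shift]; rfl

lemma acceptable_zero_iff (A : Set (ℝ × ℝ)) (t : ℝ) (ω : Outcome) :
    Acceptable A t ω 0 ↔ 0 < nextTime t (ω.1 0) ∧ (nextTime t (ω.1 0), (ω.1 0).2) ∈ A :=
  Iff.rfl

lemma salePrice_of_first {A : Set (ℝ × ℝ)} {t : ℝ} {ω : Outcome} {n : ℕ}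
    (h : Acceptable A t ω n) (hlt : ∀ k < n, ¬ Acceptable A t ω k) :
    salePrice A t ω = offer n ω := by
  classical
  have hex : ∃ n, Acceptable A t ω n := ⟨n, h⟩
  rw [salePrice, dif_pos hex]
  congr 1
  convert (Nat.find_eq_iff hex).2 ⟨h, hlt⟩

lemma salePrice_of_not_exists {A : Set (ℝ × ℝ)} {t : ℝ} {ω : Outcome}
    (h : ¬ ∃ n, Acceptable A t ω n) : salePrice A t ω = ω.2 := by
  rw [salePrice, dif_neg h]; rfl

lemma exists_first {A : Set (ℝ × ℝ)} {t : ℝ} {ω : Outcome} (h : ∃ n, Acceptable A t ω n) :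
    ∃ n, Acceptable A t ω n ∧ ∀ k < n, ¬ Acceptable A t ω k := by
  classical
  exact ⟨Nat.find h, Nat.find_spec h, fun k hk => Nat.find_min h hk⟩

lemma salePrice_eq_shift {A : Set (ℝ × ℝ)} {t : ℝ} {ω : Outcome} (h : ¬ Acceptable A t ω 0) :
    salePrice A t ω = salePrice A (nextTime t (ω.1 0)) (shift ω) := by
  by_cases hex : ∃ n, Acceptable A (nextTime t (ω.1 0)) (shift ω) n
  · obtain ⟨n, hn, hlt⟩ := exists_first hex
    rw [salePrice_of_first hn hlt,
      salePrice_of_first ((acceptable_succ_iff A t ω n).2 hn) fun k hk => ?_]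
    · rfl
    · cases k with
      | zero => exact h
      | succ k => exact fun hk' => hlt k (by omega) ((acceptable_succ_iff A t ω k).1 hk')
  · rw [salePrice_of_not_exists hex, salePrice_of_not_exists]
    · rfl
    · rintro ⟨n, hn⟩
      cases n with
      | zero => exact h hn
      | succ n => exact hex ⟨n, (acceptable_succ_iff A t ω n).1 hn⟩

/-- Only the part of a policy at positive remaining times matters. -/
lemma salePrice_congr {A B : Set (ℝ × ℝ)} (h : ∀ s x, 0 < s → ((s, x) ∈ A ↔ (s, x) ∈ B))
    (t : ℝ) : salePrice A t = salePrice B t := by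
  have hacc : ∀ ω n, Acceptable A t ω n ↔ Acceptable B t ω n := fun ω n =>
    and_congr_right fun h0 => h _ _ h0
  funext ω
  by_cases hex : ∃ n, Acceptable A t ω n
  · obtain ⟨n, hn, hlt⟩ := exists_first hex
    rw [salePrice_of_first hn hlt, salePrice_of_first ((hacc ω n).1 hn)
      fun k hk hB => hlt k hk ((hacc ω k).2 hB)]
  · rw [salePrice_of_not_exists hex, salePrice_of_not_exists]
    rintro ⟨n, hn⟩
    exact hex ⟨n, (hacc ω n).2 hn⟩

open Classical in
/-- Decide on the first `n` offers only: the reward is `g` of the accepted offer if there is one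
among them, and `h` of the remaining time otherwise. -/
noncomputable def stage (A : Set (ℝ × ℝ)) (g h : ℝ → ENNReal) : ℕ → ℝ → (ℕ → ℝ × ℝ) → ENNReal
  | 0, t, _ => h t
  | n + 1, t, w =>
    if 0 < nextTime t (w 0) ∧ (nextTime t (w 0), (w 0).2) ∈ A then g (w 0).2
    else stage A g h n (nextTime t (w 0)) fun k => w (k + 1)

open Classical in
lemma stage_eq (A : Set (ℝ × ℝ)) (g h : ℝ → ENNReal) (n : ℕ) (t : ℝ) (ω : Outcome) :
    stage A g h n t ω.1 = if ∃ k < n, Acceptable A t ω k then g (salePrice A t ω)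
      else h (remaining t ω n) := by
  induction n generalizing t ω with
  | zero => simp [stage, remaining]
  | succ n ih =>
    simp only [stage, ← acceptable_zero_iff]
    by_cases h0 : Acceptable A t ω 0
    · rw [if_pos h0, if_pos ⟨0, n.succ_pos, h0⟩, salePrice_of_first h0 (by simp)]
      rfl
    · have hiff : (∃ k < n + 1, Acceptable A t ω k) ↔
          ∃ k < n, Acceptable A (nextTime t (ω.1 0)) (shift ω) k := by
        constructor
        · rintro ⟨k, hk, hA⟩
          cases k with
          | zero => exact absurd hA h0
          | succ k => exact ⟨k, by omega, (acceptable_succ_iff A t ω k).1 hA⟩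
        · rintro ⟨k, hk, hA⟩
          exact ⟨k + 1, by omega, (acceptable_succ_iff A t ω k).2 hA⟩
      rw [if_neg h0, remaining_succ_eq_shift, salePrice_eq_shift h0]
      simp only [hiff]
      exact ih _ (shift ω)

/-! ### Measurability -/

lemma measurable_remaining (t : ℝ) (n : ℕ) : Measurable fun ω : Outcome => remaining t ω n := by
  induction n with
  | zero => exact measurable_const
  | succ n ih =>
    have : Measurable fun ω : Outcome => waiting n ω := by unfold waiting; fun_prop
    exact (ih.sub this).max measurable_const

lemma measurable_offer (n : ℕ) : Measurable (offer n) := by unfold offer; fun_prop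

lemma measurableSet_acceptable {A : Set (ℝ × ℝ)} (hA : MeasurableSet A) (t : ℝ) (n : ℕ) :
    MeasurableSet {ω | Acceptable A t ω n} :=
  (measurableSet_lt measurable_const (measurable_remaining t (n + 1))).inter
    (((measurable_remaining t (n + 1)).prodMk (measurable_offer n)) hA)

lemma measurableSet_exists_acceptable {A : Set (ℝ × ℝ)} (hA : MeasurableSet A) (t : ℝ) :
    MeasurableSet {ω | ∃ n, Acceptable A t ω n} := by
  have : {ω | ∃ n, Acceptable A t ω n} = ⋃ n, {ω | Acceptable A t ω n} := by ext; simp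
  rw [this]
  exact MeasurableSet.iUnion fun n => measurableSet_acceptable hA t n

lemma measurable_salePrice {A : Set (ℝ × ℝ)} (hA : MeasurableSet A) (t : ℝ) :
    Measurable (salePrice A t) := by
  classical
  -- With this predicate the search terminates at every outcome, at index `0` when nothing is sold.
  have hex : ∀ ω : Outcome, ∃ n, Acceptable A t ω n ∨ ¬ ∃ k, Acceptable A t ω k := fun ω => by
    by_cases h : ∃ n, Acceptable A t ω n
    · exact h.imp fun n hn => Or.inl hn
    · exact ⟨0, Or.inr h⟩
  have hp : ∀ n, MeasurableSet {ω | Acceptable A t ω n ∨ ¬ ∃ k, Acceptable A t ω k} := fun n =>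
    (measurableSet_acceptable hA t n).union (measurableSet_exists_acceptable hA t).compl
  have h := Measurable.find (f := fun n ω => if Acceptable A t ω n then offer n ω else ω.2)
    (p := fun n ω => Acceptable A t ω n ∨ ¬ ∃ k, Acceptable A t ω k)
    (fun n => Measurable.ite (measurableSet_acceptable hA t n) (measurable_offer n)
      measurable_snd) hp hex
  convert h using 1
  funext ω
  set N := Nat.find (hex ω) with hN
  by_cases hs : ∃ n, Acceptable A t ω n
  · have hacc : Acceptable A t ω N := (Nat.find_spec (hex ω)).resolve_right (not_not.2 hs)
    rw [if_pos hacc, salePrice_of_first hacc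
      fun k hk hk' => Nat.find_min (hex ω) hk (Or.inl hk')]
  · rw [if_neg fun hacc => hs ⟨N, hacc⟩, salePrice_of_not_exists hs]

lemma measurable_stage {A : Set (ℝ × ℝ)} (hA : MeasurableSet A) {g h : ℝ → ENNReal}
    (hg : Measurable g) (hh : Measurable h) (n : ℕ) :
    Measurable fun z : ℝ × (ℕ → ℝ × ℝ) => stage A g h n z.1 z.2 := by
  induction n with
  | zero => exact hh.comp measurable_fst
  | succ n ih =>
    have hw : Measurable fun z : ℝ × (ℕ → ℝ × ℝ) => z.2 0 :=
      (measurable_pi_apply 0).comp measurable_snd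
    have hnext : Measurable fun z : ℝ × (ℕ → ℝ × ℝ) => nextTime z.1 (z.2 0) :=
      measurable_nextTime.comp (measurable_fst.prodMk hw)
    refine Measurable.ite ((measurableSet_lt measurable_const hnext).inter
      ((hnext.prodMk (measurable_snd.comp hw)) hA)) (hg.comp (measurable_snd.comp hw)) ?_
    refine ih.comp (hnext.prodMk (measurable_pi_lambda _ fun k => ?_))
    exact (measurable_pi_apply (k + 1)).comp measurable_snd

/-! ### Finitely many offers arrive before the deadline -/

/-- Law of the sequence of waiting times and offers. -/
noncomputable abbrev sequenceLaw (lam : ℝ) (ν : Measure ℝ) : Measure (ℕ → ℝ × ℝ) :=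
  Measure.infinitePi fun _ : ℕ => (expMeasure lam).prod ν

section
variable {lam : ℝ} {ν : Measure ℝ} [IsProbabilityMeasure ν] [IsProbabilityMeasure (expMeasure lam)]

omit [IsProbabilityMeasure ν] [IsProbabilityMeasure (expMeasure lam)] in
lemma ae_nonneg_expMeasure : ∀ᵐ r ∂(expMeasure lam), 0 ≤ r := by
  rw [ae_iff]
  have : {r : ℝ | ¬ 0 ≤ r} = Iio 0 := by ext; simp
  rw [this, expMeasure, gammaMeasure, withDensity_apply _ measurableSet_Iio]
  exact lintegral_gammaPDF_of_nonpos le_rfl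

variable (lam ν) in
lemma ae_waiting_nonneg : ∀ᵐ w ∂(sequenceLaw lam ν), ∀ n, 0 ≤ (w n).1 := by
  rw [ae_all_iff]
  intro n
  have h1 : ∀ᵐ q ∂((expMeasure lam).prod ν), 0 ≤ q.1 :=
    Measure.quasiMeasurePreserving_fst.ae ae_nonneg_expMeasure
  exact (measurePreserving_eval_infinitePi (fun _ : ℕ => (expMeasure lam).prod ν)
    n).quasiMeasurePreserving.ae h1

lemma expMeasure_Iic_one_lt (hlam : 0 < lam) : expMeasure lam (Iic 1) < 1 := by
  rw [← ofReal_cdf, cdf_expMeasure_eq hlam, if_pos zero_le_one, ← ENNReal.ofReal_one]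
  refine (ENNReal.ofReal_lt_ofReal_iff one_pos).2 ?_
  linarith [Real.exp_pos (-(lam * 1))]

variable (ν) in
/-- Almost surely infinitely many waiting times exceed `1`; hence their sum diverges. -/
lemma ae_frequently_waiting_gt (hlam : 0 < lam) :
    ∀ᵐ w ∂(sequenceLaw lam ν), ∀ K : ℕ, ∃ k, K ≤ k ∧ 1 < (w k).1 := by
  rw [ae_all_iff]
  intro K
  rw [ae_iff]
  set s : Set (ℝ × ℝ) := {q | q.1 ≤ 1} with hs
  have hsm : MeasurableSet s := measurableSet_le measurable_fst measurable_const
  have hq : (expMeasure lam).prod ν s < 1 := by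
    have : s = Iic 1 ×ˢ univ := by ext; simp [hs]
    rw [this, Measure.prod_prod, measure_univ, mul_one]
    exact expMeasure_Iic_one_lt hlam
  refine le_antisymm (ge_of_tendsto' (ENNReal.tendsto_pow_atTop_nhds_zero_of_lt_one hq)
    fun n => ?_) zero_le
  calc _ ≤ sequenceLaw lam ν (((Finset.Ico K (K + n) : Finset ℕ) : Set ℕ).pi fun _ => s) := by
        refine measure_mono fun w hw k hk => ?_
        have hw' : ∀ k, K ≤ k → (w k).1 ≤ 1 := by simpa using hw
        exact hw' k (Finset.mem_Ico.1 hk).1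
    _ = _ := by
        rw [Measure.infinitePi_pi _ fun _ _ => hsm]
        simp

lemma remaining_nonneg {t : ℝ} (ht : 0 ≤ t) (ω : Outcome) (n : ℕ) : 0 ≤ remaining t ω n := by
  cases n with
  | zero => exact ht
  | succ n => exact le_max_right _ _

lemma remaining_antitone {t : ℝ} (ht : 0 ≤ t) {ω : Outcome} (hw : ∀ n, 0 ≤ (ω.1 n).1) :
    Antitone (remaining t ω) := by
  refine antitone_nat_of_succ_le fun n => max_le ?_ (remaining_nonneg ht ω n)
  have : 0 ≤ waiting n ω := hw n
  linarith

lemma exists_remaining_eq_zero {t : ℝ} (ht : 0 ≤ t) {ω : Outcome} (hw : ∀ n, 0 ≤ (ω.1 n).1)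
    (hf : ∀ K : ℕ, ∃ k, K ≤ k ∧ 1 < (ω.1 k).1) : ∃ n, remaining t ω n = 0 := by
  by_contra! hne
  have hpos : ∀ n, 0 < remaining t ω n := fun n =>
    lt_of_le_of_ne (remaining_nonneg ht ω n) (hne n).symm
  -- Each waiting time above `1` lowers the remaining time by more than `1`.
  have key : ∀ j : ℕ, ∃ n, remaining t ω n ≤ t - j := by
    intro j
    induction j with
    | zero => exact ⟨0, by simp [remaining]⟩
    | succ j ih =>
      obtain ⟨n, hn⟩ := ih
      obtain ⟨k, hk, hk1⟩ := hf n
      refine ⟨k + 1, ?_⟩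
      have h1 : remaining t ω (k + 1) = remaining t ω k - waiting k ω := by
        have := hpos (k + 1)
        rw [remaining] at this ⊢
        exact max_eq_left ((lt_max_iff.1 this).resolve_right (lt_irrefl _)).le
      have h2 := remaining_antitone ht hw hk
      have h3 : 1 < waiting k ω := hk1
      push_cast
      linarith
  obtain ⟨j, hj⟩ := exists_nat_gt t
  obtain ⟨n, hn⟩ := key j
  linarith [hpos n]

/-! ### Expected rewards by one-step analysis -/

open Classical in
/-- Expected reward when the seller decides on the first offer according to `A`, receives `g` of the
offer if it is accepted and `h` of the time remaining otherwise. -/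
noncomputable def oneStep (lam : ℝ) (ν : Measure ℝ) (A : Set (ℝ × ℝ)) (g h : ℝ → ENNReal)
    (t : ℝ) : ENNReal :=
  ∫⁻ q, (if 0 < nextTime t q ∧ (nextTime t q, q.2) ∈ A then g q.2 else h (nextTime t q))
    ∂((expMeasure lam).prod ν)

open Classical in
/-- The reward of a policy: `g` of the accepted offer, or `c` if no offer is accepted. It does not
involve the residual price, which is set to `0` to form an outcome. -/
noncomputable def settled (A : Set (ℝ × ℝ)) (g : ℝ → ENNReal) (c : ENNReal) (t : ℝ)
    (w : ℕ → ℝ × ℝ) : ENNReal :=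
  if ∃ k, Acceptable A t (w, 0) k then g (salePrice A t (w, 0)) else c

variable {A : Set (ℝ × ℝ)} {g h : ℝ → ENNReal}

open Classical in
lemma lintegral_stage_succ (hA : MeasurableSet A) (hg : Measurable g) (hh : Measurable h) (n : ℕ)
    (t : ℝ) : ∫⁻ w, stage A g h (n + 1) t w ∂(sequenceLaw lam ν) =
      ∫⁻ q, (if 0 < nextTime t q ∧ (nextTime t q, q.2) ∈ A then g q.2
        else ∫⁻ w, stage A g h n (nextTime t q) w ∂(sequenceLaw lam ν))
      ∂((expMeasure lam).prod ν) := by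
  rw [lintegral_infinitePi_prepend _ (f := fun w => stage A g h (n + 1) t w)
    ((measurable_stage hA hg hh (n + 1)).comp measurable_prodMk_left)]
  refine lintegral_congr fun q => ?_
  by_cases hq : 0 < nextTime t q ∧ (nextTime t q, q.2) ∈ A
  · rw [if_pos hq]
    simp [stage, prepend, hq.1, hq.2]
  · rw [if_neg hq]
    refine lintegral_congr fun w => ?_
    rw [stage]
    exact if_neg hq

lemma lintegral_stage_le (hA : MeasurableSet A) (hg : Measurable g) (hh : Measurable h)
    (hstep : ∀ t, 0 ≤ t → oneStep lam ν A g h t ≤ h t) (n : ℕ) {t : ℝ} (ht : 0 ≤ t) :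
    ∫⁻ w, stage A g h n t w ∂(sequenceLaw lam ν) ≤ h t := by
  induction n generalizing t with
  | zero => simp [stage]
  | succ n ih =>
    rw [lintegral_stage_succ hA hg hh]
    refine (lintegral_mono fun q => ?_).trans (hstep t ht)
    split_ifs
    exacts [le_rfl, ih (nextTime_nonneg t q)]

lemma lintegral_stage_eq (hA : MeasurableSet A) (hg : Measurable g) (hh : Measurable h)
    (hstep : ∀ t, 0 ≤ t → oneStep lam ν A g h t = h t) (n : ℕ) {t : ℝ} (ht : 0 ≤ t) :
    ∫⁻ w, stage A g h n t w ∂(sequenceLaw lam ν) = h t := by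
  induction n generalizing t with
  | zero => simp [stage]
  | succ n ih =>
    rw [lintegral_stage_succ hA hg hh, ← hstep t ht]
    refine lintegral_congr fun q => ?_
    split_ifs
    exacts [rfl, ih (nextTime_nonneg t q)]

lemma ae_tendsto_stage (hlam : 0 < lam) {t : ℝ} (ht : 0 ≤ t) :
    ∀ᵐ w ∂(sequenceLaw lam ν), Tendsto (fun n => stage A g h n t w) atTop
      (𝓝 (settled A g (h 0) t w)) := by
  classical
  filter_upwards [ae_waiting_nonneg lam ν, ae_frequently_waiting_gt ν hlam] with w hw hf
  obtain ⟨n₀, hn₀⟩ := exists_remaining_eq_zero (ω := (w, 0)) ht hw hf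
  have hz : ∀ n, n₀ ≤ n → remaining t (w, 0) n = 0 := fun n hn =>
    le_antisymm ((remaining_antitone (ω := (w, 0)) ht hw hn).trans hn₀.le) (remaining_nonneg ht _ n)
  refine tendsto_const_nhds.congr' ?_
  filter_upwards [eventually_ge_atTop n₀] with n hn
  have hiff : (∃ k, Acceptable A t (w, 0) k) ↔ ∃ k < n, Acceptable A t (w, 0) k := by
    refine ⟨fun ⟨k, hk⟩ => ⟨k, ?_, hk⟩, fun ⟨k, _, hk⟩ => ⟨k, hk⟩⟩
    by_contra hkn
    have := hk.1
    rw [hz (k + 1) (by omega)] at this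
    exact lt_irrefl _ this
  rw [stage_eq A g h n t (w, 0), hz n hn, settled]
  simp only [hiff]

/-- Verification inequality: a function that the one-step operator does not increase bounds the
expected reward. This is Fatou's lemma along the truncated problems. -/
lemma lintegral_settled_le (hlam : 0 < lam) (hA : MeasurableSet A) (hg : Measurable g)
    (hh : Measurable h) (hstep : ∀ t, 0 ≤ t → oneStep lam ν A g h t ≤ h t) {t : ℝ} (ht : 0 ≤ t) :
    ∫⁻ w, settled A g (h 0) t w ∂(sequenceLaw lam ν) ≤ h t := by
  have hm : ∀ n, Measurable fun w => stage A g h n t w := fun n =>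
    (measurable_stage hA hg hh n).comp measurable_prodMk_left
  calc ∫⁻ w, settled A g (h 0) t w ∂(sequenceLaw lam ν)
      = ∫⁻ w, liminf (fun n => stage A g h n t w) atTop ∂(sequenceLaw lam ν) :=
        lintegral_congr_ae ((ae_tendsto_stage hlam ht).mono fun w hw => hw.liminf_eq.symm)
    _ ≤ liminf (fun n => ∫⁻ w, stage A g h n t w ∂(sequenceLaw lam ν)) atTop :=
        lintegral_liminf_le hm
    _ ≤ liminf (fun _ : ℕ => h t) atTop :=
        liminf_le_liminf (Eventually.of_forall fun n => lintegral_stage_le hA hg hh hstep n ht)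
    _ = h t := liminf_const _

/-- Verification: a locally bounded fixed point of the one-step operator is the expected reward. -/
lemma lintegral_settled_eq (hlam : 0 < lam) (hA : MeasurableSet A) (hg : Measurable g)
    (hh : Measurable h) (hstep : ∀ t, 0 ≤ t → oneStep lam ν A g h t = h t) {t : ℝ} (ht : 0 ≤ t)
    {C : ENNReal} (hC : C ≠ ⊤) (hbd : ∀ s ∈ Icc 0 t, h s ≤ C) :
    ∫⁻ w, settled A g (h 0) t w ∂(sequenceLaw lam ν) = h t := by
  classical
  have hm : ∀ n, Measurable fun w => stage A g h n t w := fun n =>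
    (measurable_stage hA hg hh n).comp measurable_prodMk_left
  have hlim := tendsto_lintegral_of_dominated_convergence
    (μ := sequenceLaw lam ν) (fun w => settled A g (h 0) t w + C) hm (fun n => ?_) ?_
    (ae_tendsto_stage hlam ht)
  · simp_rw [lintegral_stage_eq hA hg hh hstep _ ht] at hlim
    exact tendsto_nhds_unique tendsto_const_nhds hlim |>.symm
  · filter_upwards [ae_waiting_nonneg lam ν] with w hw
    rw [stage_eq A g h n t (w, 0)]
    split_ifs with hk
    · rw [settled, if_pos (hk.imp fun k hk => hk.2)]
      exact le_self_add
    · refine (hbd _ ⟨remaining_nonneg ht _ n, ?_⟩).trans le_add_self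
      exact remaining_antitone (ω := (w, 0)) ht hw (Nat.zero_le n)
  · rw [lintegral_add_right _ measurable_const, lintegral_const, measure_univ, mul_one]
    refine ENNReal.add_ne_top.2 ⟨ne_top_of_le_ne_top ?_
      (lintegral_settled_le hlam hA hg hh (fun s hs => (hstep s hs).le) ht), hC⟩
    exact ne_top_of_le_ne_top hC (hbd t ⟨ht, le_rfl⟩)

/-! ### The residual price -/

variable {ν₀ : Measure ℝ} [IsProbabilityMeasure ν₀]

lemma acceptable_congr (t : ℝ) (w : ℕ → ℝ × ℝ) (x y : ℝ) (n : ℕ) :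
    Acceptable A t (w, x) n ↔ Acceptable A t (w, y) n := by
  have hr : ∀ n, remaining t (w, x) n = remaining t (w, y) n := fun n => by
    induction n with
    | zero => rfl
    | succ n ih => rw [remaining, remaining, ih]; rfl
  simp only [Acceptable, hr, offer]

open Classical in
lemma salePrice_eq_ite (t : ℝ) (w : ℕ → ℝ × ℝ) (x : ℝ) : salePrice A t (w, x) =
    if ∃ k, Acceptable A t (w, 0) k then salePrice A t (w, 0) else x := by
  split_ifs with hex
  · obtain ⟨n, hn, hlt⟩ := exists_first hex
    rw [salePrice_of_first hn hlt, salePrice_of_first ((acceptable_congr t w x 0 n).2 hn)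
      fun k hk hB => hlt k hk ((acceptable_congr t w x 0 k).1 hB)]
    rfl
  · rw [salePrice_of_not_exists]
    simpa only [acceptable_congr t w x 0] using hex

omit [IsProbabilityMeasure ν] [IsProbabilityMeasure (expMeasure lam)] in
/-- By independence, the residual price may be averaged out first. -/
lemma lintegral_salePrice (hA : MeasurableSet A) (hg : Measurable g) (t : ℝ) :
    ∫⁻ ω, g (salePrice A t ω) ∂(law lam ν ν₀) =
      ∫⁻ w, settled A g (∫⁻ x, g x ∂ν₀) t w ∂(sequenceLaw lam ν) := by
  classical
  rw [law, lintegral_prod (fun ω => g (salePrice A t ω))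
    (hg.comp (measurable_salePrice hA t)).aemeasurable]
  refine lintegral_congr fun w => ?_
  rw [lintegral_congr fun x => congrArg g (salePrice_eq_ite (A := A) t w x), settled]
  split_ifs <;> simp

open Classical in
lemma integral_salePrice {t : ℝ} (hint : Integrable (salePrice A t) (law lam ν ν₀)) :
    ∫ ω, salePrice A t ω ∂(law lam ν ν₀) = ∫ w, (if ∃ k, Acceptable A t (w, 0) k
      then salePrice A t (w, 0) else ∫ x, x ∂ν₀) ∂(sequenceLaw lam ν) := by
  rw [law] at hint ⊢
  rw [integral_prod _ hint]
  refine integral_congr_ae (ae_of_all _ fun w => ?_)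
  beta_reduce
  rw [integral_congr_ae (ae_of_all _ fun x => salePrice_eq_ite (A := A) t w x)]
  split_ifs <;> simp

end

/-! ### The one-step operator as an integral over time -/

open Classical in
/-- Expected reward at the arrival of an offer when the remaining time is `s`: `g` of the offer if
it is accepted, `h s` otherwise. At `s = 0` nothing can be accepted. -/
noncomputable def offerReward (ν : Measure ℝ) (A : Set (ℝ × ℝ)) (g h : ℝ → ENNReal) (s : ℝ) :
    ENNReal :=
  ∫⁻ x, (if 0 < s ∧ (s, x) ∈ A then g x else h s) ∂ν

section
variable {lam : ℝ} {ν : Measure ℝ} [IsProbabilityMeasure ν] {A : Set (ℝ × ℝ)} {g h : ℝ → ENNReal}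

open Classical in
lemma measurable_reward (hA : MeasurableSet A) (hg : Measurable g) (hh : Measurable h) :
    Measurable fun z : ℝ × ℝ => if 0 < z.1 ∧ (z.1, z.2) ∈ A then g z.2 else h z.1 :=
  Measurable.ite ((measurableSet_lt measurable_const measurable_fst).inter hA)
    (hg.comp measurable_snd) (hh.comp measurable_fst)

lemma measurable_offerReward (hA : MeasurableSet A) (hg : Measurable g) (hh : Measurable h) :
    Measurable (offerReward ν A g h) :=
  (measurable_reward hA hg hh).lintegral_prod_right'

lemma offerReward_zero : offerReward ν A g h 0 = h 0 := by simp [offerReward]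

lemma expMeasure_Ioi (hlam : 0 < lam) {t : ℝ} (ht : 0 ≤ t) :
    expMeasure lam (Ioi t) = ENNReal.ofReal (Real.exp (-(lam * t))) := by
  have := isProbabilityMeasure_expMeasure hlam
  rw [← ofReal_one_sub_cdf, cdf_expMeasure_eq hlam, if_pos ht]
  congr 1; ring

lemma setLIntegral_Iic_expMeasure {F : ℝ → ENNReal} (hF : Measurable F)
    {t : ℝ} (ht : 0 ≤ t) : ∫⁻ r in Iic t, F r ∂(expMeasure lam) =
      ∫⁻ r in Ioc 0 t, ENNReal.ofReal (lam * Real.exp (-(lam * r))) * F r := by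
  have hpdf : Measurable (exponentialPDF lam) :=
    (measurable_exponentialPDFReal lam).ennreal_ofReal
  have h1 : expMeasure lam = volume.withDensity (exponentialPDF lam) := rfl
  have hd : Disjoint (Iic (0:ℝ)) (Ioc 0 t) :=
    disjoint_left.2 fun u hu hu' => not_lt_of_ge (show u ≤ 0 from hu) hu'.1
  rw [h1, setLIntegral_withDensity_eq_setLIntegral_mul _ hpdf hF measurableSet_Iic,
    ← Iic_union_Ioc_eq_Iic ht, lintegral_union measurableSet_Ioc hd]
  have h2 : ∫⁻ r in Iic (0:ℝ), (exponentialPDF lam * F) r = 0 := by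
    rw [setLIntegral_congr (Iio_ae_eq_Iic).symm,
      setLIntegral_eq_zero_iff measurableSet_Iio (hpdf.mul hF)]
    refine ae_of_all _ fun r hr => ?_
    simp [exponentialPDF_of_neg hr]
  rw [h2, zero_add]
  refine setLIntegral_congr_fun measurableSet_Ioc fun r hr => ?_
  simp [exponentialPDF_of_nonneg hr.1.le]

lemma oneStep_eq (hlam : 0 < lam) (hA : MeasurableSet A) (hg : Measurable g) (hh : Measurable h)
    {t : ℝ} (ht : 0 ≤ t) : oneStep lam ν A g h t =
      (∫⁻ r in Ioc 0 t, ENNReal.ofReal (lam * Real.exp (-(lam * r))) *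
        offerReward ν A g h (t - r)) + h 0 * ENNReal.ofReal (Real.exp (-(lam * t))) := by
  classical
  have := isProbabilityMeasure_expMeasure hlam
  have hn : Measurable fun r : ℝ => max (t - r) 0 := by fun_prop
  have hF : Measurable fun r : ℝ => offerReward ν A g h (max (t - r) 0) :=
    (measurable_offerReward hA hg hh).comp hn
  have hmeas : Measurable fun q : ℝ × ℝ => if 0 < nextTime t q ∧ (nextTime t q, q.2) ∈ A
      then g q.2 else h (nextTime t q) :=
    (measurable_reward hA hg hh).comp ((hn.comp measurable_fst).prodMk measurable_snd)
  have e1 : oneStep lam ν A g h t =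
      ∫⁻ r, offerReward ν A g h (max (t - r) 0) ∂(expMeasure lam) := by
    rw [oneStep, lintegral_prod _ hmeas.aemeasurable]
    rfl
  rw [e1, ← lintegral_add_compl _ (measurableSet_Iic (a := t)), compl_Iic,
    setLIntegral_Iic_expMeasure hF ht]
  congr 1
  · refine setLIntegral_congr_fun measurableSet_Ioc fun r hr => ?_
    simp only [max_eq_left (sub_nonneg.2 hr.2)]
  · rw [← expMeasure_Ioi hlam ht, ← setLIntegral_const]
    refine setLIntegral_congr_fun measurableSet_Ioi fun r hr => ?_
    have : t - r ≤ 0 := sub_nonpos.2 (le_of_lt hr)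
    simp only [max_eq_right this, offerReward_zero]

/-- The integrated form of the differential equation `f' = λ (k - f)`. -/
lemma integral_exp_mul_eq {f f' k : ℝ → ℝ} (hf : Continuous f)
    (hf' : ∀ s, 0 ≤ s → HasDerivWithinAt f (f' s) (Ioi s) s)
    (hk : ∀ s, lam * k s = f' s + lam * f s) {t : ℝ} (ht : 0 ≤ t)
    (hki : IntervalIntegrable k volume 0 t) :
    ∫ r in (0:ℝ)..t, lam * Real.exp (-(lam * r)) * k (t - r) =
      f t - Real.exp (-(lam * t)) * f 0 := by
  have h1 := intervalIntegral.integral_comp_sub_left (a := 0) (b := t)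
    (fun s => lam * Real.exp (-(lam * (t - s))) * k s) t
  simp only [sub_sub_cancel, sub_zero, sub_self] at h1
  rw [h1, intervalIntegral.integral_eq_sub_of_hasDeriv_right_of_le ht
    (f := fun s => Real.exp (-(lam * (t - s))) * f s)]
  · simp
  · exact Continuous.continuousOn (by fun_prop)
  · intro s hs
    have he : HasDerivAt (fun s => Real.exp (-(lam * (t - s))))
        (Real.exp (-(lam * (t - s))) * lam) s := by
      refine HasDerivAt.exp (f := fun s => -(lam * (t - s))) ?_
      exact (((hasDerivAt_id' s).const_sub t).const_mul lam).fun_neg.congr_deriv (by ring)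
    refine (he.hasDerivWithinAt.mul (hf' s hs.1.le)).congr_deriv ?_
    linear_combination (-Real.exp (-(lam * (t - s)))) * hk s
  · refine hki.continuousOn_mul (Continuous.continuousOn ?_)
    fun_prop

lemma lintegral_exp_mul_add_eq (hlam : 0 < lam) {f f' k : ℝ → ℝ} (hf : Continuous f)
    (hf' : ∀ s, 0 ≤ s → HasDerivWithinAt f (f' s) (Ioi s) s)
    (hk : ∀ s, lam * k s = f' s + lam * f s) (hf0 : 0 ≤ f 0) (hk0 : ∀ s, 0 ≤ s → 0 ≤ k s)
    {t : ℝ} (ht : 0 ≤ t) (hki : IntervalIntegrable k volume 0 t) :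
    (∫⁻ r in Ioc 0 t, ENNReal.ofReal (lam * Real.exp (-(lam * r))) * ENNReal.ofReal (k (t - r))) +
      ENNReal.ofReal (f 0) * ENNReal.ofReal (Real.exp (-(lam * t))) = ENNReal.ofReal (f t) := by
  have hnn : ∀ r ∈ Ioc 0 t, 0 ≤ lam * Real.exp (-(lam * r)) * k (t - r) := fun r hr =>
    mul_nonneg (by positivity) (hk0 _ (sub_nonneg.2 hr.2))
  have hint : IntervalIntegrable (fun r => lam * Real.exp (-(lam * r)) * k (t - r))
      volume 0 t := by
    refine IntervalIntegrable.continuousOn_mul ?_ (Continuous.continuousOn (by fun_prop))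
    have := hki.comp_sub_left t
    simpa using this.symm
  have e : ∫⁻ r in Ioc 0 t, ENNReal.ofReal (lam * Real.exp (-(lam * r))) *
      ENNReal.ofReal (k (t - r)) =
      ENNReal.ofReal (∫ r in (0:ℝ)..t, lam * Real.exp (-(lam * r)) * k (t - r)) := by
    rw [intervalIntegral.integral_of_le ht, ofReal_integral_eq_lintegral_ofReal
      ((intervalIntegrable_iff_integrableOn_Ioc_of_le ht).1 hint)
      ((ae_restrict_mem measurableSet_Ioc).mono hnn)]
    refine lintegral_congr fun r => ?_
    rw [ENNReal.ofReal_mul (q := k (t - r)) (by positivity)]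
  have hnn' : 0 ≤ ∫ r in (0:ℝ)..t, lam * Real.exp (-(lam * r)) * k (t - r) := by
    rw [intervalIntegral.integral_of_le ht]
    exact setIntegral_nonneg measurableSet_Ioc hnn
  rw [e, ← ENNReal.ofReal_mul hf0, ← ENNReal.ofReal_add hnn' (by positivity),
    integral_exp_mul_eq hf hf' hk ht hki]
  congr 1; ring

lemma ae_comp_sub {P : ℝ → Prop} (h : ∀ᵐ s, P s) (t : ℝ) : ∀ᵐ r : ℝ, P (t - r) :=
  (Measure.measurePreserving_sub_left volume t).quasiMeasurePreserving.ae h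

/-- If an offer arriving at remaining time `s` yields at most `k(s)`, where `f' = λ (k - f)`, then `f`
is not increased by the one-step operator. -/
lemma oneStep_le_ofReal (hlam : 0 < lam) (hA : MeasurableSet A) (hg : Measurable g)
    {f f' k : ℝ → ℝ} (hf : Continuous f)
    (hf' : ∀ s, 0 ≤ s → HasDerivWithinAt f (f' s) (Ioi s) s)
    (hk : ∀ s, lam * k s = f' s + lam * f s) (hf0 : 0 ≤ f 0) (hk0 : ∀ s, 0 ≤ s → 0 ≤ k s)
    (hki : ∀ t, 0 ≤ t → IntervalIntegrable k volume 0 t)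
    (hr : ∀ᵐ s, 0 ≤ s →
      offerReward ν A g (fun s => ENNReal.ofReal (f s)) s ≤ ENNReal.ofReal (k s))
    {t : ℝ} (ht : 0 ≤ t) :
    oneStep lam ν A g (fun s => ENNReal.ofReal (f s)) t ≤ ENNReal.ofReal (f t) := by
  rw [oneStep_eq hlam hA hg hf.measurable.ennreal_ofReal ht,
    ← lintegral_exp_mul_add_eq hlam hf hf' hk hf0 hk0 ht (hki t ht)]
  refine add_le_add (setLIntegral_mono_ae' measurableSet_Ioc ?_) le_rfl
  filter_upwards [ae_comp_sub hr t] with r h hrt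
  exact mul_le_mul_right (h (sub_nonneg.2 hrt.2)) _

lemma oneStep_eq_ofReal (hlam : 0 < lam) (hA : MeasurableSet A) (hg : Measurable g)
    {f f' k : ℝ → ℝ} (hf : Continuous f)
    (hf' : ∀ s, 0 ≤ s → HasDerivWithinAt f (f' s) (Ioi s) s)
    (hk : ∀ s, lam * k s = f' s + lam * f s) (hf0 : 0 ≤ f 0) (hk0 : ∀ s, 0 ≤ s → 0 ≤ k s)
    (hki : ∀ t, 0 ≤ t → IntervalIntegrable k volume 0 t)
    (hr : ∀ᵐ s, 0 < s →
      offerReward ν A g (fun s => ENNReal.ofReal (f s)) s = ENNReal.ofReal (k s))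
    {t : ℝ} (ht : 0 ≤ t) :
    oneStep lam ν A g (fun s => ENNReal.ofReal (f s)) t = ENNReal.ofReal (f t) := by
  rw [oneStep_eq hlam hA hg hf.measurable.ennreal_ofReal ht,
    ← lintegral_exp_mul_add_eq hlam hf hf' hk hf0 hk0 ht (hki t ht)]
  congr 1
  refine setLIntegral_congr_fun_ae measurableSet_Ioc ?_
  have hne : ∀ᵐ r : ℝ, r ≠ t := by simp [ae_iff, measure_singleton]
  filter_upwards [ae_comp_sub hr t, hne] with r h hrt' hrt
  rw [h (sub_pos.2 (lt_of_le_of_ne hrt.2 hrt'))]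

/-! ### Rewards of the threshold policy -/

variable {a : ℝ} {m : ℝ → ℝ}

lemma ofReal_add_phi (hν : Integrable (fun x : ℝ => max x 0) ν) {y : ℝ} (hy : 0 ≤ y) :
    ENNReal.ofReal (y + phi ν y) =
      ∫⁻ x, (ENNReal.ofReal y + ENNReal.ofReal (x - y)) ∂ν := by
  rw [lintegral_add_left measurable_const, lintegral_const, measure_univ, mul_one,
    ← ofReal_phi hν, ENNReal.ofReal_add hy (phi_nonneg y)]

/-- No decision on an offer yields more in expectation than `m + φ(m)`. -/
lemma offerReward_le (hν : Integrable (fun x : ℝ => max x 0) ν) {s : ℝ} (hs : 0 ≤ m s) :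
    offerReward ν A ENNReal.ofReal (fun s => ENNReal.ofReal (m s)) s ≤
      ENNReal.ofReal (m s + phi ν (m s)) := by
  classical
  rw [ofReal_add_phi hν hs, offerReward]
  refine lintegral_mono fun x => ?_
  split_ifs
  · calc ENNReal.ofReal x = ENNReal.ofReal (m s + (x - m s)) := by congr 1; ring
      _ ≤ _ := ENNReal.ofReal_add_le
  · exact le_self_add

/-- Accept an offer if and only if it is at least `m` of the remaining time. -/
def threshold (m : ℝ → ℝ) : Set (ℝ × ℝ) := {q | m q.1 ≤ q.2}

lemma measurableSet_threshold (hm : Continuous m) : MeasurableSet (threshold m) :=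
  (isClosed_le (by fun_prop) (by fun_prop)).measurableSet

lemma offerReward_threshold (hν : Integrable (fun x : ℝ => max x 0) ν) {s : ℝ} (hs : 0 ≤ m s)
    (h0 : 0 < s) :
    offerReward ν (threshold m) ENNReal.ofReal (fun s => ENNReal.ofReal (m s)) s =
      ENNReal.ofReal (m s + phi ν (m s)) := by
  classical
  rw [ofReal_add_phi hν hs, offerReward]
  refine lintegral_congr fun x => ?_
  by_cases hx : m s ≤ x
  · rw [if_pos ⟨h0, hx⟩, ← ENNReal.ofReal_add hs (sub_nonneg.2 hx)]
    congr 1; ring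
  · rw [if_neg fun h => hx h.2, ENNReal.ofReal_of_nonpos (p := x - m s)
      (by linarith [not_le.1 hx]), add_zero]

/-- The threshold is strictly monotone in time, so it meets the countably many atoms of the offer
law only at countably many times. -/
lemma ae_measure_singleton_eq_zero (hm : Function.Injective m) :
    ∀ᵐ s : ℝ, ν {m s} = 0 := by
  have hc : {x : ℝ | 0 < ν {x}}.Countable :=
    Measure.countable_meas_pos_of_disjoint_iUnion (fun x => measurableSet_singleton x)
      fun x y hxy => by simpa using hxy
  have := (hc.preimage hm).ae_notMem volume
  filter_upwards [this] with s hs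
  simpa using hs

/-- With `y = m(s)`, the reward is `X² 1{X > y} + (y² + v) 1{X ≤ y} =
y² + 2 y (X - y)⁺ + ((X - y)⁺)² + v 1{X ≤ y}`, up to the null event `X = y`. -/
lemma offerReward_threshold_sq (hν : Integrable (fun x : ℝ => max x 0) ν)
    (hi : ∀ x, IntegrableOn (phi ν) (Ioi x)) {v : ℝ → ℝ} {s : ℝ} (hs : 0 ≤ m s) (hv : 0 ≤ v s)
    (h0 : 0 < s) (hat : ν {m s} = 0) :
    offerReward ν (threshold m) (fun x => ENNReal.ofReal (x ^ 2))
        (fun s => ENNReal.ofReal (m s ^ 2 + v s)) s =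
      ENNReal.ofReal (m s ^ 2 + 2 * m s * phi ν (m s) + 2 * iteratedTail ν (m s) +
        v s * cdf ν (m s)) := by
  classical
  have hT : 0 ≤ iteratedTail ν (m s) := integral_nonneg fun u => phi_nonneg u
  have hφ := phi_nonneg (ν := ν) (m s)
  have hc := cdf_nonneg ν (m s)
  have hrhs : ENNReal.ofReal (m s ^ 2 + 2 * m s * phi ν (m s) + 2 * iteratedTail ν (m s) +
        v s * cdf ν (m s)) =
      ∫⁻ x, (ENNReal.ofReal (m s ^ 2) + ENNReal.ofReal (2 * m s) * ENNReal.ofReal (x - m s) +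
        ENNReal.ofReal 2 * ENNReal.ofReal ((max (x - m s) 0) ^ 2 / 2) +
        ENNReal.ofReal (v s) * (Iic (m s)).indicator 1 x) ∂ν := by
    have hind : Measurable fun x => ENNReal.ofReal (v s) *
        (Iic (m s)).indicator (1 : ℝ → ENNReal) x :=
      measurable_const.mul (measurable_one.indicator measurableSet_Iic)
    rw [lintegral_add_right _ hind,
      lintegral_add_right _ (by fun_prop), lintegral_add_left measurable_const,
      lintegral_const, measure_univ, mul_one, lintegral_const_mul _ (by fun_prop),
      lintegral_const_mul _ (by fun_prop), lintegral_const_mul _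
        (measurable_one.indicator measurableSet_Iic), lintegral_indicator_one measurableSet_Iic,
      ← ofReal_phi hν, ← ofReal_iteratedTail hν hi, ← ofReal_cdf,
      ← ENNReal.ofReal_mul (by positivity), ← ENNReal.ofReal_mul (by positivity),
      ← ENNReal.ofReal_mul hv, ← ENNReal.ofReal_add (by positivity) (by positivity),
      ← ENNReal.ofReal_add (by positivity) (by positivity),
      ← ENNReal.ofReal_add (by positivity) (by positivity)]
  rw [hrhs, offerReward]
  have hne : ∀ᵐ x ∂ν, x ≠ m s := by simpa [ae_iff] using hat
  refine lintegral_congr_ae ?_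
  filter_upwards [hne] with x hx
  rcases lt_or_gt_of_ne hx with h | h
  · have hx' : ¬ (0 < s ∧ (s, x) ∈ threshold m) := fun hh => not_lt_of_ge hh.2 h
    rw [if_neg hx', indicator_of_mem (show x ∈ Iic (m s) from h.le), ENNReal.ofReal_of_nonpos
      (p := x - m s) (by linarith), max_eq_right (by linarith : x - m s ≤ 0),
      ENNReal.ofReal_add (by positivity) hv]
    simp
  · have hx' : 0 < s ∧ (s, x) ∈ threshold m := ⟨h0, h.le⟩
    rw [if_pos hx', indicator_of_notMem (show x ∉ Iic (m s) from not_le.2 h),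
      max_eq_left (by linarith : 0 ≤ x - m s), mul_zero, add_zero,
      ← ENNReal.ofReal_mul (by positivity), ← ENNReal.ofReal_mul (by positivity),
      ← ENNReal.ofReal_add (by positivity) (mul_nonneg (by positivity) (by linarith)),
      ← ENNReal.ofReal_add (add_nonneg (by positivity)
        (mul_nonneg (by positivity) (by linarith))) (by positivity)]
    congr 1; ring

end

/-! ### The value and the variance of the optimal policy -/

section
variable {lam : ℝ} {ν ν₀ : Measure ℝ} [IsProbabilityMeasure ν] [IsProbabilityMeasure ν₀]
  {a : ℝ} {m : ℝ → ℝ} {A : Set (ℝ × ℝ)}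

lemma isProbabilityMeasure_law (hlam : 0 < lam) : IsProbabilityMeasure (law lam ν ν₀) := by
  have := isProbabilityMeasure_expMeasure hlam
  unfold law
  infer_instance

omit [IsProbabilityMeasure ν] in
lemma SolvesValueEquation.nonneg (hm : SolvesValueEquation lam ν a m) (ha : 0 ≤ a) {t : ℝ}
    (ht : 0 ≤ t) : 0 ≤ m t := ha.trans (hm.le ht)

open Classical in
lemma ofReal_ite_eq_settled (A : Set (ℝ × ℝ)) (t : ℝ) (w : ℕ → ℝ × ℝ) (c : ℝ) :
    ENNReal.ofReal (if ∃ k, Acceptable A t (w, 0) k then salePrice A t (w, 0) else c) =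
      settled A ENNReal.ofReal (ENNReal.ofReal c) t w := by
  rw [settled]
  split_ifs <;> rfl

lemma SolvesValueEquation.lintegral_settled_le (hm : SolvesValueEquation lam ν a m)
    (hlam : 0 < lam) (ha : 0 ≤ a) (hν : Integrable (fun x : ℝ => max x 0) ν)
    (hA : MeasurableSet A) {t : ℝ} (ht : 0 ≤ t) :
    ∫⁻ w, settled A ENNReal.ofReal (ENNReal.ofReal a) t w ∂(sequenceLaw lam ν) ≤
      ENNReal.ofReal (m t) := by
  have := isProbabilityMeasure_expMeasure hlam
  have h := SellingProblem.lintegral_settled_le (ν := ν) (h := fun s => ENNReal.ofReal (m s)) hlam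
    hA ENNReal.measurable_ofReal hm.continuous.measurable.ennreal_ofReal (fun s hs => ?_) ht
  · simpa only [hm.zero] using h
  · refine oneStep_le_ofReal (k := fun s => m s + phi ν (m s)) hlam hA ENNReal.measurable_ofReal
      hm.continuous (fun s hs => (hm.hasDerivAt s hs).hasDerivWithinAt) (fun s => by ring)
      (hm.nonneg ha le_rfl) (fun s hs => add_nonneg (hm.nonneg ha hs) (phi_nonneg _))
      (fun s _ => Continuous.intervalIntegrable
        (hm.continuous.add ((phi_continuous hν).comp hm.continuous)) _ _)
      (ae_of_all _ fun s hs => offerReward_le hν (hm.nonneg ha hs)) hs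

lemma SolvesValueEquation.lintegral_settled_threshold (hm : SolvesValueEquation lam ν a m)
    (hlam : 0 < lam) (ha : 0 ≤ a) (hν : Integrable (fun x : ℝ => max x 0) ν) {t : ℝ} (ht : 0 ≤ t) :
    ∫⁻ w, settled (threshold m) ENNReal.ofReal (ENNReal.ofReal a) t w ∂(sequenceLaw lam ν) =
      ENNReal.ofReal (m t) := by
  have := isProbabilityMeasure_expMeasure hlam
  have hA := measurableSet_threshold hm.continuous
  have h := lintegral_settled_eq (ν := ν) (h := fun s => ENNReal.ofReal (m s)) hlam
    hA ENNReal.measurable_ofReal hm.continuous.measurable.ennreal_ofReal (fun s hs => ?_) ht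
    (C := ENNReal.ofReal (m t)) ENNReal.ofReal_ne_top
    (fun s hs => ENNReal.ofReal_le_ofReal (hm.strictMono.monotone hs.2))
  · simpa only [hm.zero] using h
  · refine oneStep_eq_ofReal (k := fun s => m s + phi ν (m s)) hlam hA ENNReal.measurable_ofReal
      hm.continuous (fun s hs => (hm.hasDerivAt s hs).hasDerivWithinAt) (fun s => by ring)
      (hm.nonneg ha le_rfl) (fun s hs => add_nonneg (hm.nonneg ha hs) (phi_nonneg _))
      (fun s _ => Continuous.intervalIntegrable
        (hm.continuous.add ((phi_continuous hν).comp hm.continuous)) _ _)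
      (ae_of_all _ fun s hs => offerReward_threshold hν (hm.nonneg ha hs.le) hs) hs

/-- No policy does better than `m`. Accepted negative offers are replaced by `0` in the bound, so
that the lower tail of the offers plays no role. -/
lemma SolvesValueEquation.integral_salePrice_le (hm : SolvesValueEquation lam ν a m)
    (hlam : 0 < lam) (ha : a = ∫ x, x ∂ν₀) (ha0 : 0 ≤ a)
    (hν : Integrable (fun x : ℝ => max x 0) ν) (hA : MeasurableSet A) {t : ℝ} (ht : 0 ≤ t)
    (hint : Integrable (salePrice A t) (law lam ν ν₀)) :
    ∫ ω, salePrice A t ω ∂(law lam ν ν₀) ≤ m t := by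
  classical
  have := isProbabilityMeasure_expMeasure hlam
  rw [integral_salePrice hint, ← ha]
  set D : (ℕ → ℝ × ℝ) → ℝ := fun w =>
    if ∃ k, Acceptable A t (w, 0) k then salePrice A t (w, 0) else a with hD
  by_cases hDi : Integrable D (sequenceLaw lam ν)
  · rw [integral_eq_lintegral_pos_part_sub_lintegral_neg_part hDi]
    have h1 : ∫⁻ w, ENNReal.ofReal (D w) ∂(sequenceLaw lam ν) ≤ ENNReal.ofReal (m t) := by
      simp_rw [hD, ofReal_ite_eq_settled]
      exact hm.lintegral_settled_le hlam ha0 hν hA ht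
    have h2 := ENNReal.toReal_mono ENNReal.ofReal_ne_top h1
    rw [ENNReal.toReal_ofReal (hm.nonneg ha0 ht)] at h2
    exact (sub_le_self _ ENNReal.toReal_nonneg).trans h2
  · rw [integral_undef hDi]
    exact hm.nonneg ha0 ht

omit [IsProbabilityMeasure ν] in
/-- The threshold policy accepts only nonnegative offers. -/
lemma SolvesValueEquation.salePrice_nonneg (hm : SolvesValueEquation lam ν a m) (ha0 : 0 ≤ a)
    {t : ℝ} {ω : Outcome} (h : ∃ k, Acceptable (threshold m) t ω k) :
    0 ≤ salePrice (threshold m) t ω := by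
  obtain ⟨n, hn, hlt⟩ := exists_first h
  rw [salePrice_of_first hn hlt]
  exact (hm.nonneg ha0 hn.1.le).trans hn.2

lemma SolvesValueEquation.integrable_salePrice (hm : SolvesValueEquation lam ν a m)
    (hlam : 0 < lam) (ha0 : 0 ≤ a) (hν : Integrable (fun x : ℝ => max x 0) ν)
    (hν₀ : Integrable (fun x : ℝ => x) ν₀) {t : ℝ} (ht : 0 ≤ t) :
    Integrable (salePrice (threshold m) t) (law lam ν ν₀) := by
  have := isProbabilityMeasure_expMeasure hlam
  have hA := measurableSet_threshold hm.continuous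
  refine ⟨(measurable_salePrice hA t).aestronglyMeasurable, ?_⟩
  rw [hasFiniteIntegral_iff_enorm, lintegral_salePrice (g := fun x => ‖x‖ₑ) hA measurable_enorm]
  refine lt_of_le_of_lt (lintegral_mono (g := fun w =>
    settled (threshold m) ENNReal.ofReal (ENNReal.ofReal a) t w + ∫⁻ x, ‖x‖ₑ ∂ν₀) fun w => ?_) ?_
  · simp only [settled]
    split_ifs with h
    · rw [Real.enorm_of_nonneg (hm.salePrice_nonneg ha0 h)]
      exact le_self_add
    · exact le_add_self
  · rw [lintegral_add_right _ measurable_const, hm.lintegral_settled_threshold hlam ha0 hν ht,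
      lintegral_const, measure_univ, mul_one]
    exact ENNReal.add_lt_top.2 ⟨ENNReal.ofReal_lt_top, hν₀.hasFiniteIntegral⟩

lemma SolvesValueEquation.integral_salePrice_threshold (hm : SolvesValueEquation lam ν a m)
    (hlam : 0 < lam) (ha : a = ∫ x, x ∂ν₀) (ha0 : 0 ≤ a)
    (hν : Integrable (fun x : ℝ => max x 0) ν) (hν₀ : Integrable (fun x : ℝ => x) ν₀)
    {t : ℝ} (ht : 0 ≤ t) :
    ∫ ω, salePrice (threshold m) t ω ∂(law lam ν ν₀) = m t := by
  classical
  have := isProbabilityMeasure_expMeasure hlam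
  have hA := measurableSet_threshold hm.continuous
  have h0 : Measurable fun w : ℕ → ℝ × ℝ => ((w, 0) : Outcome) :=
    measurable_id.prodMk measurable_const
  have hDm : Measurable fun w : ℕ → ℝ × ℝ => if ∃ k, Acceptable (threshold m) t (w, 0) k
      then salePrice (threshold m) t (w, 0) else a :=
    Measurable.ite (h0 (measurableSet_exists_acceptable hA t))
      ((measurable_salePrice hA t).comp h0) measurable_const
  rw [integral_salePrice (hm.integrable_salePrice hlam ha0 hν hν₀ ht), ← ha,
    integral_eq_lintegral_of_nonneg_ae (ae_of_all _ fun w => ?_) hDm.aestronglyMeasurable]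
  · simp_rw [ofReal_ite_eq_settled]
    rw [hm.lintegral_settled_threshold hlam ha0 hν ht, ENNReal.toReal_ofReal (hm.nonneg ha0 ht)]
  · simp only [Pi.zero_apply]
    split_ifs with h
    exacts [hm.salePrice_nonneg ha0 h, ha0]

lemma SolvesValueEquation.optimalValue_eq (hm : SolvesValueEquation lam ν a m)
    (hlam : 0 < lam) (ha : a = ∫ x, x ∂ν₀) (ha0 : 0 ≤ a)
    (hν : Integrable (fun x : ℝ => max x 0) ν) (hν₀ : Integrable (fun x : ℝ => x) ν₀)
    {t : ℝ} (ht : 0 ≤ t) : optimalValue lam ν ν₀ t = m t := by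
  refine IsGreatest.csSup_eq ⟨⟨threshold m, measurableSet_threshold hm.continuous,
    hm.integrable_salePrice hlam ha0 hν hν₀ ht,
    (hm.integral_salePrice_threshold hlam ha ha0 hν hν₀ ht).symm⟩, ?_⟩
  rintro v ⟨A, hA, hint, rfl⟩
  exact hm.integral_salePrice_le hlam ha ha0 hν hA ht hint

lemma SolvesValueEquation.optimalSalePrice_eq (hm : SolvesValueEquation lam ν a m)
    (hlam : 0 < lam) (ha : a = ∫ x, x ∂ν₀) (ha0 : 0 ≤ a)
    (hν : Integrable (fun x : ℝ => max x 0) ν) (hν₀ : Integrable (fun x : ℝ => x) ν₀) (t : ℝ) :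
    optimalSalePrice lam ν ν₀ t = salePrice (threshold m) t := by
  refine salePrice_congr (fun s x hs => ?_) t
  simp only [optimalPolicy, threshold, Set.mem_ofPred_eq,
    hm.optimalValue_eq hlam ha ha0 hν hν₀ hs.le]

/-- The second moment of the price is `m² + v`, a fixed point of the one-step operator for the
reward `x²`. -/
lemma SolvesValueEquation.lintegral_salePrice_sq (hm : SolvesValueEquation lam ν a m)
    (hlam : 0 < lam) (ha0 : 0 ≤ a) (hν : Integrable (fun x : ℝ => max x 0) ν)
    (hM : supportSup ν = ⊤) (hi : ∀ x, IntegrableOn (phi ν) (Ioi x))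
    (hsq : Integrable (fun x : ℝ => x ^ 2) ν₀) {v₀ : ℝ} (hv₀ : v₀ = (∫ x, x ^ 2 ∂ν₀) - a ^ 2)
    (hv₀0 : 0 ≤ v₀) {t : ℝ} (ht : 0 ≤ t) :
    ∫⁻ ω, ENNReal.ofReal (salePrice (threshold m) t ω ^ 2) ∂(law lam ν ν₀) =
      ENNReal.ofReal (m t ^ 2 + varianceSolution lam ν m v₀ t) := by
  have := isProbabilityMeasure_expMeasure hlam
  have hA := measurableSet_threshold hm.continuous
  set v := varianceSolution lam ν m v₀ with hv
  have hvc : Continuous v := hm.continuous_varianceSolution hν hM hi v₀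
  have hv0 : ∀ s, 0 ≤ s → 0 ≤ v s := fun s hs => varianceSolution_nonneg hlam hv₀0 hs
  have hfc : Continuous fun s => m s ^ 2 + v s := (hm.continuous.pow 2).add hvc
  have hg : Measurable fun x : ℝ => ENNReal.ofReal (x ^ 2) := by fun_prop
  have hstart : ∫⁻ x, ENNReal.ofReal (x ^ 2) ∂ν₀ = ENNReal.ofReal (m 0 ^ 2 + v 0) := by
    rw [← ofReal_integral_eq_lintegral_ofReal hsq (ae_of_all _ fun x => sq_nonneg x), hm.zero, hv,
      varianceSolution_zero hν hM, hv₀]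
    congr 1; ring
  rw [lintegral_salePrice hA hg, hstart]
  obtain ⟨C, hC⟩ := (isCompact_Icc (a := (0:ℝ)) (b := t)).exists_bound_of_continuousOn
    hfc.continuousOn
  refine lintegral_settled_eq (h := fun s => ENNReal.ofReal (m s ^ 2 + v s)) hlam hA hg
    hfc.measurable.ennreal_ofReal (fun s hs => ?_) ht (C := ENNReal.ofReal C)
    ENNReal.ofReal_ne_top
    (fun s hs => ENNReal.ofReal_le_ofReal ((le_abs_self _).trans (hC s hs)))
  refine oneStep_eq_ofReal (k := fun s => m s ^ 2 + 2 * m s * phi ν (m s) +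
      2 * iteratedTail ν (m s) + v s * cdf ν (m s))
    (f' := fun s => 2 * m s * (lam * phi ν (m s)) +
      (2 * lam * iteratedTail ν (m s) - lam * (1 - cdf ν (m s)) * v s)) hlam hA hg hfc
    (fun s hs => ?_) (fun s => by ring) (add_nonneg (sq_nonneg _) (hv0 0 le_rfl))
    (fun s hs => ?_) (fun s _ => ?_) ?_ hs
  · refine HasDerivWithinAt.add ?_ (hm.varianceSolution_hasDerivWithinAt hν hM hi v₀ hs)
    exact (((hm.hasDerivAt s hs).fun_pow 2).congr_deriv (by ring)).hasDerivWithinAt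
  · have h1 := hm.nonneg ha0 hs
    have h2 := phi_nonneg (ν := ν) (m s)
    have h3 : 0 ≤ iteratedTail ν (m s) := integral_nonneg fun u => phi_nonneg u
    have h4 := cdf_nonneg ν (m s)
    have h5 := hv0 s hs
    positivity
  · refine IntervalIntegrable.add (Continuous.intervalIntegrable ?_ _ _) ?_
    · exact ((hm.continuous.pow 2).add ((continuous_const.mul hm.continuous).mul
        ((phi_continuous hν).comp hm.continuous))).add
        (continuous_const.mul ((iteratedTail_continuous hν hi).comp hm.continuous))
    · exact IntervalIntegrable.continuousOn_mul
        ((monotone_cdf ν).comp hm.strictMono.monotone).intervalIntegrable hvc.continuousOn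
  · filter_upwards [ae_measure_singleton_eq_zero (ν := ν) hm.strictMono.injective] with s hat hs
    exact offerReward_threshold_sq hν hi (hm.nonneg ha0 hs.le) (hv0 s hs.le) hs hat

lemma SolvesValueEquation.memLp_salePrice (hm : SolvesValueEquation lam ν a m)
    (hlam : 0 < lam) (ha0 : 0 ≤ a) (hν : Integrable (fun x : ℝ => max x 0) ν)
    (hM : supportSup ν = ⊤) (hi : ∀ x, IntegrableOn (phi ν) (Ioi x))
    (hsq : Integrable (fun x : ℝ => x ^ 2) ν₀) {v₀ : ℝ} (hv₀ : v₀ = (∫ x, x ^ 2 ∂ν₀) - a ^ 2)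
    (hv₀0 : 0 ≤ v₀) {t : ℝ} (ht : 0 ≤ t) :
    MemLp (salePrice (threshold m) t) 2 (law lam ν ν₀) := by
  have hmeas := measurable_salePrice (measurableSet_threshold hm.continuous) t
  rw [memLp_two_iff_integrable_sq hmeas.aestronglyMeasurable]
  refine ⟨(hmeas.pow_const 2).aestronglyMeasurable, ?_⟩
  rw [hasFiniteIntegral_iff_ofReal (ae_of_all _ fun ω => sq_nonneg _),
    hm.lintegral_salePrice_sq hlam ha0 hν hM hi hsq hv₀ hv₀0 ht]
  exact ENNReal.ofReal_lt_top

lemma SolvesValueEquation.variance_salePrice (hm : SolvesValueEquation lam ν a m)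
    (hlam : 0 < lam) (ha : a = ∫ x, x ∂ν₀) (ha0 : 0 ≤ a)
    (hν : Integrable (fun x : ℝ => max x 0) ν) (hν₀ : Integrable (fun x : ℝ => x) ν₀)
    (hM : supportSup ν = ⊤) (hi : ∀ x, IntegrableOn (phi ν) (Ioi x))
    (hsq : Integrable (fun x : ℝ => x ^ 2) ν₀) {v₀ : ℝ} (hv₀ : v₀ = (∫ x, x ^ 2 ∂ν₀) - a ^ 2)
    (hv₀0 : 0 ≤ v₀) {t : ℝ} (ht : 0 ≤ t) :
    variance (salePrice (threshold m) t) (law lam ν ν₀) = varianceSolution lam ν m v₀ t := by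
  have := isProbabilityMeasure_law (ν := ν) (ν₀ := ν₀) hlam
  have hL := hm.memLp_salePrice hlam ha0 hν hM hi hsq hv₀ hv₀0 ht
  have hmeas := measurable_salePrice (measurableSet_threshold hm.continuous) t
  rw [variance_eq_sub hL, hm.integral_salePrice_threshold hlam ha ha0 hν hν₀ ht]
  simp only [Pi.pow_apply]
  rw [integral_eq_lintegral_of_nonneg_ae (ae_of_all _ fun ω => sq_nonneg _)
    (hmeas.pow_const 2).aestronglyMeasurable,
    hm.lintegral_salePrice_sq hlam ha0 hν hM hi hsq hv₀ hv₀0 ht,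
    ENNReal.toReal_ofReal (add_nonneg (sq_nonneg _) (varianceSolution_nonneg hlam hv₀0 ht))]
  ring

end

/-! ### Regular variation of the variance -/

section
variable {f m : ℝ → ℝ} {κ ρ : ℝ}

/-- A function asymptotic to a multiple of `m²` inherits twice the exponent of `m`. -/
lemma tendsto_ratio_of_tendsto_div_sq (hκ : 0 < κ) (hm : ∀ᶠ t in atTop, 0 < m t)
    (hf : Tendsto (fun t => f t / m t ^ 2) atTop (𝓝 κ)) {x : ℝ} (hx : 0 < x)
    (hr : Tendsto (fun s => m (x * s) / m s) atTop (𝓝 (x ^ ρ))) :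
    Tendsto (fun s => f (x * s) / f s) atTop (𝓝 (x ^ (2 * ρ))) := by
  have hxs : Tendsto (fun s : ℝ => x * s) atTop atTop := tendsto_id.const_mul_atTop hx
  have h := ((hf.comp hxs).div hf hκ.ne').mul (hr.pow 2)
  have e : κ / κ * (x ^ ρ) ^ 2 = x ^ (2 * ρ) := by
    rw [div_self hκ.ne', one_mul, ← Real.rpow_natCast, ← Real.rpow_mul hx.le]
    congr 1; push_cast; ring
  rw [e] at h
  refine h.congr' ?_
  filter_upwards [hm, hxs.eventually hm] with s h1 h2
  simp only [Function.comp, Pi.div_apply]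
  field_simp

lemma div_rpow_eq_mul_sq (hm : ∀ᶠ t in atTop, 0 < m t) (c : ℝ) :
    (fun t => (f t / m t ^ 2) * ((m t / t ^ (c / 2)) * (m t / t ^ (c / 2)))) =ᶠ[atTop]
      fun t => f t / t ^ c := by
  filter_upwards [hm, eventually_gt_atTop 0] with t h1 h2
  have e : t ^ c = t ^ (c / 2) * t ^ (c / 2) := by
    rw [← Real.rpow_add h2]; congr 1; ring
  have h3 : 0 < t ^ (c / 2) := Real.rpow_pos_of_pos h2 _
  rw [e]
  field_simp

end

end SellingProblem

theorem mainTheorem10 (lam p : ℝ) (ν ν₀ : MeasureTheory.Measure ℝ)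
    [MeasureTheory.IsProbabilityMeasure ν] [MeasureTheory.IsProbabilityMeasure ν₀]
    (hlam : 0 < lam) (hp : 0 < p)
    (hν : MeasureTheory.Integrable (fun x : ℝ => max x 0) ν)
    (hν₀ : MeasureTheory.Integrable (fun x : ℝ => x) ν₀)
    (hμ₀ : 0 ≤ ∫ x, x ∂ν₀)
    (hM : SellingProblem.supportSup ν = ⊤)
    (hφ : Tendsto (fun x : ℝ =>
        x * SellingProblem.phi ν x / ∫ u in Ioi x, SellingProblem.phi ν u) atTop (𝓝 p)) :
    (SellingProblem.RegularlyVarying (SellingProblem.optimalValue lam ν ν₀) (1 / (p + 2)) ∧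
      (∀ c : ℝ, c < 1 / (p + 2) →
        Tendsto (fun t : ℝ => SellingProblem.optimalValue lam ν ν₀ t / t ^ c) atTop atTop) ∧
      (∀ c : ℝ, 1 / (p + 2) < c →
        Tendsto (fun t : ℝ => SellingProblem.optimalValue lam ν ν₀ t / t ^ c) atTop (𝓝 0))) ∧
    (MeasureTheory.Integrable (fun x : ℝ => x ^ 2) ν₀ →
      (∀ t : ℝ, 0 ≤ t → MeasureTheory.MemLp (SellingProblem.optimalSalePrice lam ν ν₀ t) 2
        (SellingProblem.law lam ν ν₀)) ∧
      SellingProblem.RegularlyVarying (SellingProblem.priceVariance lam ν ν₀) (2 / (p + 2)) ∧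
      (∀ c : ℝ, c < 2 / (p + 2) →
        Tendsto (fun t : ℝ => SellingProblem.priceVariance lam ν ν₀ t / t ^ c) atTop atTop) ∧
      (∀ c : ℝ, 2 / (p + 2) < c →
        Tendsto (fun t : ℝ => SellingProblem.priceVariance lam ν ν₀ t / t ^ c) atTop (𝓝 0))) := by
  open SellingProblem in
  obtain ⟨m, hm⟩ := exists_solvesValueEquation hlam hν hM (∫ x, x ∂ν₀)
  have hi := integrableOn_phi hν hp hφ
  have hlog := hm.tendsto_logDeriv hlam hp hν hM hφ
  have hpos : ∀ᶠ t in atTop, 0 < m t := hm.tendsto.eventually_gt_atTop 0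
  have hder : ∀ᶠ t in atTop, HasDerivAt m (lam * phi ν (m t)) t := by
    filter_upwards [eventually_ge_atTop 0] with t ht using hm.hasDerivAt t ht
  have hopt : ∀ t, 0 ≤ t → optimalValue lam ν ν₀ t = m t := fun t ht =>
    hm.optimalValue_eq hlam rfl hμ₀ hν hν₀ ht
  have hopt' : ∀ᶠ t in atTop, m t = optimalValue lam ν ν₀ t := by
    filter_upwards [eventually_ge_atTop 0] with t ht using (hopt t ht).symm
  have hgt : ∀ {c}, c < 1 / (p + 2) → Tendsto (fun t => m t / t ^ c) atTop atTop := fun hc =>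
    tendsto_div_rpow_atTop_of_logDeriv hder hpos hlog hc
  have hlt : ∀ {c}, 1 / (p + 2) < c → Tendsto (fun t => m t / t ^ c) atTop (𝓝 0) := fun hc =>
    tendsto_div_rpow_zero_of_logDeriv hder hpos hlog hc
  refine ⟨⟨⟨?_, fun t ht => ?_, fun x hx => ?_⟩, fun c hc => ?_, fun c hc => ?_⟩, fun hsq => ?_⟩
  · have : (fun t : Ici (0:ℝ) => optimalValue lam ν ν₀ t) = fun t : Ici (0:ℝ) => m t :=
      funext fun t => hopt t t.2
    rw [this]
    exact hm.continuous.measurable.comp measurable_subtype_coe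
  · rw [hopt t ht]; exact hm.nonneg hμ₀ ht
  · refine (tendsto_ratio_of_logDeriv hder hpos hlog hx).congr' ?_
    filter_upwards [eventually_ge_atTop 0] with s hs
    rw [hopt s hs, hopt (x * s) (by positivity)]
  · refine (hgt hc).congr' ?_
    filter_upwards [hopt'] with t ht
    rw [ht]
  · refine (hlt hc).congr' ?_
    filter_upwards [hopt'] with t ht
    rw [ht]
  have hL₀ : MemLp (fun x : ℝ => x) 2 ν₀ :=
    (memLp_two_iff_integrable_sq measurable_id.aestronglyMeasurable).2 hsq
  obtain ⟨v₀, hv₀⟩ : ∃ v₀, v₀ = (∫ x, x ^ 2 ∂ν₀) - (∫ x, x ∂ν₀) ^ 2 := ⟨_, rfl⟩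
  have hv₀0 : 0 ≤ v₀ := by
    have h := variance_nonneg (fun x : ℝ => x) ν₀
    rw [variance_eq_sub hL₀] at h
    rw [hv₀]
    exact h
  have hS := hm.optimalSalePrice_eq (ν₀ := ν₀) hlam rfl hμ₀ hν hν₀
  have hvar : ∀ t, 0 ≤ t → priceVariance lam ν ν₀ t = varianceSolution lam ν m v₀ t :=
    fun t ht => by
      rw [priceVariance, hS]
      exact hm.variance_salePrice hlam rfl hμ₀ hν hν₀ hM hi hsq hv₀ hv₀0 ht
  have hvar' : ∀ᶠ t in atTop, varianceSolution lam ν m v₀ t = priceVariance lam ν ν₀ t := by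
    filter_upwards [eventually_ge_atTop 0] with t ht using (hvar t ht).symm
  have hκ : 0 < 2 / (p * (p + 3)) := by positivity
  have hquad := hm.tendsto_varianceSolution_div_sq hlam hp hν hM hφ v₀
  refine ⟨fun t ht => ?_, ⟨?_, fun t ht => variance_nonneg _ _, fun x hx => ?_⟩,
    fun c hc => ?_, fun c hc => ?_⟩
  · rw [hS]
    exact hm.memLp_salePrice hlam hμ₀ hν hM hi hsq hv₀ hv₀0 ht
  · have : (fun t : Ici (0:ℝ) => priceVariance lam ν ν₀ t) =
        fun t : Ici (0:ℝ) => varianceSolution lam ν m v₀ t := funext fun t => hvar t t.2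
    rw [this]
    exact (hm.continuous_varianceSolution hν hM hi v₀).measurable.comp measurable_subtype_coe
  · have h := tendsto_ratio_of_tendsto_div_sq hκ hpos hquad hx
      (tendsto_ratio_of_logDeriv hder hpos hlog hx)
    rw [mul_one_div] at h
    refine h.congr' ?_
    filter_upwards [eventually_ge_atTop 0] with s hs
    rw [hvar s hs, hvar (x * s) (by positivity)]
  · have hc' : c / 2 < 1 / (p + 2) := by
      have : 2 / (p + 2) = 2 * (1 / (p + 2)) := by ring
      linarith
    have h := (hquad.pos_mul_atTop hκ ((hgt hc').atTop_mul_atTop₀ (hgt hc'))).congr'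
      (div_rpow_eq_mul_sq hpos c)
    refine h.congr' ?_
    filter_upwards [hvar'] with t ht
    rw [ht]
  · have hc' : 1 / (p + 2) < c / 2 := by
      have : 2 / (p + 2) = 2 * (1 / (p + 2)) := by ring
      linarith
    have h := (hquad.mul ((hlt hc').mul (hlt hc'))).congr' (div_rpow_eq_mul_sq hpos c)
    rw [mul_zero, mul_zero] at h
    refine h.congr' ?_
    filter_upwards [hvar'] with t ht
    rw [ht]
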